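/- All graphs are finite and simple. Graphs $G_1,\dots,G_m$ are \emph{nearly disjoint} if $|V(G_i)\cap V(G_j)|\le 1$ for all distinct $i,j$. A list assignment $L$ for a graph $G$ assigns a finite set $L(v)$ of colors to each vertex $v\in V(G)$; $G$ is \emph{$L$-colorable} if there is a proper coloring $\varphi$ of $G$ with $\varphi(v)\in L(v)$ for every $v\in V(G)$. The \emph{maximum color degree} of $G$ and $L$ is $$\Delta(G,L):=\max_{v\in V(G)}\max_{c\in L(v)}\bigl|\{u\in N_G(v): c\in L(u)\}\bigr|$$ (and $0$ if there is no such pair $(v,c)$). For all real numbers $C,\varepsilon>0$ there is $D_0$ such that the following holds for every real $D\ge D_0$. Let $G_1,\dots,G_m$ be graphs that (i) are nearly disjoint, and (ii) satisfy $|\{i\in\{1,\dots,m\}: v\in V(G_i)\}|\le C$ for every $v\in\bigcup_{i=1}^m V(G_i)$. If $L$ is a list assignment for $G:=\bigcup_{i=1}^m G_i$ satisfying (iii) $\Delta(G_i, L|_{V(G_i)})\le D$ for every $i\in\{1,\dots,m\}$, and (iv) $|L(v)|\ge(1+\varepsilon)D$ for every $v\in V(G)$, then $G$ is $L$-colorable.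 -/

import Mathlib

/-- A finite graph whose vertex set `H.verts` is a subset of `V` is encoded as a subgraph `H` of
the complete graph on `V`. For a list assignment `L`, this is the color degree
`d_{H,L}(v,c) = |{u ∈ N_H(v) : c ∈ L(u)}|`. Only the values of `L` on `H.verts` matter. -/
noncomputable def colorDegree {V α : Type*} (H : (⊤ : SimpleGraph V).Subgraph)
    (L : V → Finset α) (v : V) (c : α) : ℕ :=
  {u ∈ H.neighborSet v | c ∈ L u}.ncard

/-- The maximum color degree `Δ(H,L) = max_{v ∈ V(H)} max_{c ∈ L(v)} d_{H,L}(v,c)`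
of a finite graph `H` (equal to `0` if there is no such pair `(v,c)`). -/
noncomputable def maxColorDegree {V α : Type*} (H : (⊤ : SimpleGraph V).Subgraph)
    (L : V → Finset α) : ℕ :=
  sSup {d : ℕ | ∃ v ∈ H.verts, ∃ c ∈ L v, d = colorDegree H L v c}

/-- Any two distinct members of the family share at most one vertex. -/
def NearlyDisjoint {V ι : Type*} (G : ι → (⊤ : SimpleGraph V).Subgraph) : Prop :=
  ∀ i j, i ≠ j → ((G i).verts ∩ (G j).verts).encard ≤ 1

/-- `H` is `L`-colorable: it has a proper coloring giving each vertex a color of its list. -/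
def IsListColorable {V α : Type*} (H : (⊤ : SimpleGraph V).Subgraph) (L : V → Finset α) : Prop :=
  ∃ φ : H.coe.Coloring α, ∀ v : H.verts, φ v ∈ L v

/-!
The proof is a nibble. All lists have size `ℓ`, each `G i` has color degrees at most `d`, and each
vertex lies in at most `N` of the graphs. Every vertex selects each color of its list with
probability `p / ℓ`, independently, and loses the colors selected by its neighbours; additional
random bits make every color survive with probability exactly `y * z`, where
`y = (1 - p / ℓ) ^ (N * d - d)` and `z = (1 - p / ℓ) ^ d`. A vertex that keeps a selected color is
colored with it. The lists of the others concentrate around `ℓ * y * z`. An uncolored neighbour in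
`G i` that keeps the color `c` has selected nothing, up to a proportion `O(p ^ 2)`, and has not lost
`c` to a vertex outside `G i`; this has probability at most `y * u`, where `u = (1 - p / ℓ) ^ ℓ`.
Since the `G i` are nearly disjoint, a vertex is adjacent outside `G i` to at most `N` vertices of
`G i`, so these events are nearly independent and the new color degrees in `G i` concentrate around
values of at most `d * y * u`. As `d ≤ ℓ / (1 + ε)`, we have `u < z` with room for the errors, so
the ratio of list size to color degree grows by a constant factor in each step. All deviations have
exponentially small probability and depend only on bits within bounded distance, so the local lemma
avoids them simultaneously. After boundedly many steps `16 * N * d ≤ ℓ`, and a uniformly random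
coloring succeeds by the local lemma.
-/

section

open Finset Function MeasureTheory ProbabilityTheory
open scoped Classical

/-! ### The symmetric local lemma -/

section LocalLemma

variable {Ω ι : Type*} {A : ι → Set Ω}

/-- The event that none of the events `A i` with `i ∈ T` occurs. -/
def avoiding (A : ι → Set Ω) (T : Finset ι) : Set Ω :=
  {ω | ∀ i ∈ T, ω ∉ A i}

lemma avoiding_empty : avoiding A ∅ = Set.univ := by simp [avoiding]

lemma avoiding_anti {S T : Finset ι} (h : S ⊆ T) : avoiding A T ⊆ avoiding A S :=
  fun _ hω i hi => hω i (h hi)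

variable [MeasurableSpace Ω] {μ : Measure Ω} {N : ι → Finset ι} {p : ℝ} {Δ : ℕ}

/-- `N i` is a neighbourhood of `i` in a dependency graph of the events `A`: avoiding events
outside `N i` is independent of `A i`. -/
def IsDependencyGraph (μ : Measure Ω) (A : ι → Set Ω) (N : ι → Finset ι) : Prop :=
  ∀ i T, Disjoint (N i) T →
    μ.real (A i ∩ avoiding A T) = μ.real (A i) * μ.real (avoiding A T)

lemma measureReal_avoiding_le_add_sum [IsFiniteMeasure μ] (S T : Finset ι) :
    μ.real (avoiding A S)
      ≤ μ.real (avoiding A (S ∪ T)) + ∑ j ∈ T, μ.real (A j ∩ avoiding A S) := by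
  have hcover : avoiding A S ⊆ avoiding A (S ∪ T) ∪ ⋃ j ∈ T, A j ∩ avoiding A S := by
    intro ω hω
    by_cases h : ∃ j ∈ T, ω ∈ A j
    · obtain ⟨j, hj, hωj⟩ := h
      exact Or.inr (Set.mem_biUnion hj ⟨hωj, hω⟩)
    · push Not at h
      exact Or.inl fun j hj => (mem_union.1 hj).elim (hω j) (h j)
  calc μ.real (avoiding A S)
      ≤ μ.real (avoiding A (S ∪ T) ∪ ⋃ j ∈ T, A j ∩ avoiding A S) := measureReal_mono hcover
    _ ≤ μ.real (avoiding A (S ∪ T)) + μ.real (⋃ j ∈ T, A j ∩ avoiding A S) :=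
        measureReal_union_le _ _
    _ ≤ _ := by gcongr; exact measureReal_biUnion_finset_le _ _

/-- The quantitative heart of the local lemma: conditionally on avoiding any finitely many
events, each event has probability at most `2 * p`. -/
lemma measureReal_inter_avoiding_le [IsFiniteMeasure μ] (hN : IsDependencyGraph μ A N)
    (hp : ∀ i, μ.real (A i) ≤ p) (hΔ : ∀ i, #(N i) ≤ Δ) (hpΔ : 4 * p * Δ ≤ 1)
    (T : Finset ι) (i : ι) :
    μ.real (A i ∩ avoiding A T) ≤ 2 * p * μ.real (avoiding A T) := by
  have hp₀ : 0 ≤ p := measureReal_nonneg.trans (hp i)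
  have hfar : μ.real (A i ∩ avoiding A T) ≤ p * μ.real (avoiding A (T \ N i)) := calc
    _ ≤ μ.real (A i ∩ avoiding A (T \ N i)) :=
        measureReal_mono (Set.inter_subset_inter_right _ (avoiding_anti sdiff_subset))
    _ = μ.real (A i) * μ.real (avoiding A (T \ N i)) := hN i _ disjoint_sdiff
    _ ≤ _ := by gcongr; exact hp i
  suffices hhalf : μ.real (avoiding A (T \ N i)) ≤ 2 * μ.real (avoiding A T) by
    calc _ ≤ p * (2 * μ.real (avoiding A T)) := hfar.trans (by gcongr)
      _ = _ := by ring
  by_cases hT : Disjoint (N i) T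
  · rw [sdiff_eq_self_of_disjoint hT.symm]
    linarith [measureReal_nonneg (μ := μ) (s := avoiding A T)]
  have : #(T \ N i) < #T := by
    obtain ⟨j, hjN, hjT⟩ := not_disjoint_iff.1 hT
    exact card_lt_card (ssubset_iff_of_subset sdiff_subset |>.2 ⟨j, hjT, by simp [hjN]⟩)
  have hnear : ∑ j ∈ T ∩ N i, μ.real (A j ∩ avoiding A (T \ N i))
      ≤ 2⁻¹ * μ.real (avoiding A (T \ N i)) := calc
    _ ≤ ∑ _j ∈ T ∩ N i, 2 * p * μ.real (avoiding A (T \ N i)) :=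
        sum_le_sum fun j _ => measureReal_inter_avoiding_le hN hp hΔ hpΔ (T \ N i) j
    _ = #(T ∩ N i) * (2 * p) * μ.real (avoiding A (T \ N i)) := by
        rw [sum_const, nsmul_eq_mul, ← mul_assoc]
    _ ≤ Δ * (2 * p) * μ.real (avoiding A (T \ N i)) := by
        gcongr
        exact (card_le_card inter_subset_right).trans (hΔ i)
    _ ≤ _ := by gcongr; linarith
  have hsplit := measureReal_avoiding_le_add_sum (μ := μ) (A := A) (T \ N i) (T ∩ N i)
  rw [sdiff_union_inter] at hsplit
  linarith
termination_by #T

theorem lovasz_local_lemma [Finite ι] [IsProbabilityMeasure μ] (hN : IsDependencyGraph μ A N)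
    (hp : ∀ i, μ.real (A i) ≤ p) (hΔ : ∀ i, #(N i) ≤ Δ) (hΔ₀ : 0 < Δ) (hpΔ : 4 * p * Δ ≤ 1) :
    ∃ ω, ∀ i, ω ∉ A i := by
  have := Fintype.ofFinite ι
  have hpos : ∀ T : Finset ι, 0 < μ.real (avoiding A T) := by
    intro T
    induction T using Finset.induction_on with
    | empty => simp [avoiding_empty]
    | insert i T _ ih =>
      have hp₀ : 0 ≤ p := measureReal_nonneg.trans (hp i)
      have hp₁ : 4 * p ≤ 1 :=
        (le_mul_of_one_le_right (by positivity) (Nat.one_le_cast.2 hΔ₀)).trans hpΔ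
      have hstep := measureReal_avoiding_le_add_sum (μ := μ) (A := A) T {i}
      have hi := measureReal_inter_avoiding_le hN hp hΔ hpΔ T i
      rw [sum_singleton, union_comm, ← insert_eq] at hstep
      nlinarith
  obtain ⟨ω, hω⟩ := nonempty_of_measureReal_ne_zero (hpos univ).ne'
  exact ⟨ω, fun i => hω i (mem_univ i)⟩

end LocalLemma

/-! ### Independence and concentration for independent bits -/

section ProductSpace

variable {B : Type*} {K : B → Type*}

lemma dependsOn_biUnion {ι E F : Type*} {I : Finset ι} {s : ι → Finset B}
    {f : ι → (∀ b, K b) → E} (hf : ∀ i ∈ I, DependsOn (f i) (s i)) (g : (I → E) → F) :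
    DependsOn (fun ω => g fun i => f i ω) (I.biUnion s : Finset B) := by
  intro x y hxy
  refine congrArg g (funext fun i => hf i i.2 fun b hb => hxy b ?_)
  exact mem_coe.2 (mem_biUnion.2 ⟨i, i.2, hb⟩)

variable [∀ b, MeasurableSpace (K b)] {μ : ∀ b, Measure (K b)}

/-- The function `f` with the coordinate `b` integrated out, that is, the conditional expectation
of `f` given all the other coordinates. -/
noncomputable def coordIntegral (μ : ∀ b, Measure (K b)) (b : B) (f : (∀ b, K b) → ℝ)
    (ω : ∀ b, K b) : ℝ :=
  ∫ k, f (update ω b k) ∂μ b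

lemma dependsOn_coordIntegral {b : B} {s : Finset B} {f : (∀ b, K b) → ℝ}
    (hf : DependsOn f (insert b s : Finset B)) : DependsOn (coordIntegral μ b f) s := by
  intro x y hxy
  refine integral_congr_ae (.of_forall fun k => hf fun i hi => ?_)
  by_cases hib : i = b
  · subst hib; simp
  · rw [update_of_ne hib, update_of_ne hib]
    exact hxy i ((mem_insert.1 hi).resolve_left hib)

variable [Fintype B] [∀ b, IsProbabilityMeasure (μ b)]

lemma measureReal_pi_finset (s : Finset B) (t : ∀ b, Set (K b)) :
    (Measure.pi μ).real ((s : Set B).pi t) = ∏ b ∈ s, (μ b).real (t b) := by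
  simp only [Measure.real, Measure.pi_pi_finset, ENNReal.toReal_prod]

variable [∀ b, Finite (K b)] [∀ b, MeasurableSingletonClass (K b)]

lemma indepFun_of_dependsOn {E F : Type*} [MeasurableSpace E] [MeasurableSpace F]
    {f : (∀ b, K b) → E} {g : (∀ b, K b) → F} {s t : Finset B} (hst : Disjoint s t)
    (hf : DependsOn f s) (hg : DependsOn g t) : IndepFun f g (Measure.pi μ) := by
  have hne : Nonempty (∀ b, K b) := nonempty_of_isProbabilityMeasure (Measure.pi μ)
  have : Nonempty E := hne.map f
  have : Nonempty F := hne.map g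
  obtain ⟨f', rfl⟩ := dependsOn_iff_exists_comp.1 hf
  obtain ⟨g', rfl⟩ := dependsOn_iff_exists_comp.1 hg
  have hcoord : iIndepFun (fun b (ω : ∀ b, K b) => ω b) (Measure.pi μ) :=
    iIndepFun_pi (X := fun _ => id) fun _ => aemeasurable_id
  exact (hcoord.indepFun_finset s t hst measurable_pi_apply).comp
    (Measurable.of_discrete (f := f')) (Measurable.of_discrete (f := g'))

lemma integral_mul_of_dependsOn {f g : (∀ b, K b) → ℝ} {s t : Finset B} (hst : Disjoint s t)
    (hf : DependsOn f s) (hg : DependsOn g t) :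
    ∫ ω, f ω * g ω ∂Measure.pi μ = (∫ ω, f ω ∂Measure.pi μ) * ∫ ω, g ω ∂Measure.pi μ :=
  (indepFun_of_dependsOn hst hf hg).integral_fun_mul_eq_mul_integral
    Measurable.of_discrete.aestronglyMeasurable Measurable.of_discrete.aestronglyMeasurable

lemma integral_prod_of_dependsOn {ι : Type*} {I : Finset ι} {f : ι → (∀ b, K b) → ℝ}
    {s : ι → Finset B} (hs : (I : Set ι).PairwiseDisjoint s)
    (hf : ∀ i ∈ I, DependsOn (f i) (s i)) :
    ∫ ω, ∏ i ∈ I, f i ω ∂Measure.pi μ = ∏ i ∈ I, ∫ ω, f i ω ∂Measure.pi μ := by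
  induction I using Finset.induction_on with
  | empty => simp
  | insert i I hi ih =>
    rw [coe_insert, Set.pairwiseDisjoint_insert_of_notMem (mem_coe.not.2 hi)] at hs
    have hfI : ∀ j ∈ I, DependsOn (f j) (s j) := fun j hj => hf j (mem_insert_of_mem hj)
    have hrest : DependsOn (fun ω => ∏ j ∈ I, f j ω) (I.biUnion s : Finset B) := by
      simp only [← prod_attach I]
      exact dependsOn_biUnion hfI fun x => ∏ j, x j
    simp only [prod_insert hi]
    rw [integral_mul_of_dependsOn ((disjoint_biUnion_right _ _ _).2 hs.2)
      (hf i (mem_insert_self i I)) hrest, ih hs.1 hfI]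

theorem lovasz_local_lemma_pi {ι : Type*} [Fintype ι] {A : ι → Set (∀ b, K b)}
    {s : ι → Finset B} {p : ℝ} {Δ : ℕ} (hA : ∀ i, DependsOn (· ∈ A i) (s i))
    (hp : ∀ i, (Measure.pi μ).real (A i) ≤ p) (hΔ : ∀ i, #{j | ¬ Disjoint (s i) (s j)} ≤ Δ)
    (hΔ₀ : 0 < Δ) (hpΔ : 4 * p * Δ ≤ 1) : ∃ ω, ∀ i, ω ∉ A i := by
  refine lovasz_local_lemma (μ := Measure.pi μ) (N := fun i => {j | ¬ Disjoint (s i) (s j)})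
    (fun i T hT => ?_) hp hΔ hΔ₀ hpΔ
  have hdisj : Disjoint (s i) (T.biUnion s) := by
    refine (disjoint_biUnion_right _ _ _).2 fun j hj => ?_
    simpa using disjoint_right.1 hT hj
  have hT' : DependsOn (· ∈ avoiding A T) (T.biUnion s : Finset B) := by
    simpa only [avoiding, Set.mem_ofPred_eq, Subtype.forall] using
      dependsOn_biUnion (fun j _ => hA j) fun P : T → Prop => ∀ j, ¬ P j
  have hindep := (indepFun_of_dependsOn (μ := μ) hdisj (hA i) hT').measure_inter_preimage_eq_mul
    {True} {True} .of_discrete .of_discrete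
  have hset : ∀ S : Set (∀ b, K b), (· ∈ S) ⁻¹' {True} = S := fun S => by ext; simp
  rw [hset, hset] at hindep
  rw [Measure.real, hindep, ENNReal.toReal_mul]; rfl

lemma measurePreserving_update (b : B) :
    MeasurePreserving (fun z : (∀ b, K b) × K b => update z.1 b z.2)
      ((Measure.pi μ).prod (μ b)) (Measure.pi μ) := by
  refine ⟨.of_discrete, (Measure.pi_eq fun t _ => ?_).symm⟩
  have hpre : (fun z : (∀ b, K b) × K b => update z.1 b z.2) ⁻¹' Set.univ.pi t
      = ((univ.erase b : Finset B) : Set B).pi t ×ˢ t b := by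
    ext ⟨ω, k⟩
    simp [Set.mem_pi, forall_update_iff ω (p := fun i x => x ∈ t i), and_comm]
  rw [Measure.map_apply .of_discrete .of_discrete, hpre, Measure.prod_prod, Measure.pi_pi_finset,
    prod_erase_mul _ _ (mem_univ b)]

lemma integral_coordIntegral (b : B) (f : (∀ b, K b) → ℝ) :
    ∫ ω, coordIntegral μ b f ω ∂Measure.pi μ = ∫ ω, f ω ∂Measure.pi μ := by
  conv_rhs => rw [← (measurePreserving_update b).map_eq]
  rw [integral_map Measurable.of_discrete.aemeasurable Measurable.of_discrete.aestronglyMeasurable,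
    integral_prod _ .of_finite]
  rfl

end ProductSpace

section Bits

/-- The law of independent bits, each of which is `true` with probability `q`. -/
noncomputable abbrev bitsMeasure (B : Type*) [Fintype B] (q : unitInterval) :
    Measure (B → Bool) :=
  Measure.pi fun _ => bernoulliMeasure true false q

lemma centered_bernoulli_exp_le {q r : ℝ} (hq₀ : 0 ≤ q) (hq₁ : q ≤ 1) (hr : |r| ≤ 1) :
    q * Real.exp ((1 - q) * r) + (1 - q) * Real.exp (-q * r) ≤ Real.exp (q * r ^ 2) := by
  have hquad {z : ℝ} (hz : |z| ≤ 1) : Real.exp z ≤ 1 + z + z ^ 2 := by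
    linarith [(abs_le.1 (Real.abs_exp_sub_one_sub_id_le hz)).2]
  have hscale {c : ℝ} (hc : |c| ≤ 1) : |c * r| ≤ 1 := by
    rw [abs_mul]
    exact mul_le_one₀ hc (abs_nonneg r) hr
  calc q * Real.exp ((1 - q) * r) + (1 - q) * Real.exp (-q * r)
      ≤ q * (1 + (1 - q) * r + ((1 - q) * r) ^ 2) + (1 - q) * (1 + -q * r + (-q * r) ^ 2) := by
        have : 0 ≤ 1 - q := by linarith
        gcongr <;> refine hquad (hscale ?_) <;> rw [abs_le] <;> constructor <;> linarith
    _ = 1 + q * r ^ 2 - (q * r) ^ 2 := by ring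
    _ ≤ q * r ^ 2 + 1 := by linarith [sq_nonneg (q * r)]
    _ ≤ Real.exp (q * r ^ 2) := Real.add_one_le_exp _

lemma bernoulli_exp_le {q x y : ℝ} (hq₀ : 0 ≤ q) (hq₁ : q ≤ 1) (hxy : |x - y| ≤ 1) :
    q * Real.exp x + (1 - q) * Real.exp y
      ≤ Real.exp (q * x + (1 - q) * y + q * (x - y) ^ 2) := by
  set m := q * x + (1 - q) * y with hm
  have hx : x = m + (1 - q) * (x - y) := by rw [hm]; ring
  have hy : y = m + -q * (x - y) := by rw [hm]; ring
  calc q * Real.exp x + (1 - q) * Real.exp y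
      = Real.exp m * (q * Real.exp ((1 - q) * (x - y)) + (1 - q) * Real.exp (-q * (x - y))) := by
        rw [mul_add, mul_left_comm, mul_left_comm (Real.exp m), ← Real.exp_add, ← Real.exp_add,
          ← hx, ← hy]
    _ ≤ Real.exp m * Real.exp (q * (x - y) ^ 2) := by
        gcongr
        exact centered_bernoulli_exp_le hq₀ hq₁ hxy
    _ = _ := (Real.exp_add _ _).symm

variable {B : Type*} {q : unitInterval}

lemma coordIntegral_bernoulliMeasure (f : (B → Bool) → ℝ) (b : B) (ω : B → Bool) :
    coordIntegral (fun _ : B => bernoulliMeasure true false q) b f ω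
      = q * f (update ω b true) + (1 - q) * f (update ω b false) := by
  simp [coordIntegral, integral_bernoulliMeasure]

lemma coordIntegral_exp_le {f : (B → Bool) → ℝ} {b : B} {ω : B → Bool} {a : ℝ} (ha : a ≤ 1)
    (hdiff : |f (update ω b true) - f (update ω b false)| ≤ a) :
    coordIntegral (fun _ : B => bernoulliMeasure true false q) b (fun ω => Real.exp (f ω)) ω
      ≤ Real.exp (coordIntegral (fun _ => bernoulliMeasure true false q) b f ω + q * a ^ 2) := by
  rw [coordIntegral_bernoulliMeasure, coordIntegral_bernoulliMeasure]
  refine (bernoulli_exp_le q.2.1 q.2.2 (hdiff.trans ha)).trans (Real.exp_le_exp.2 ?_)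
  have := q.2.1
  gcongr _ + _ * ?_
  exact sq_le_sq' (by linarith [(abs_le.1 hdiff).1]) (abs_le.1 hdiff).2

variable [Fintype B]

/-- Hoeffding's lemma would give `a ^ 2 * #s / 8` in place of `q * a ^ 2 * #s`, which is too weak
for rare bits. -/
theorem integral_exp_le_of_bounded_differences {a : ℝ} (ha : a ≤ 1) {s : Finset B}
    {f : (B → Bool) → ℝ} (hf : DependsOn f s)
    (hdiff : ∀ b ∈ s, ∀ ω, |f (update ω b true) - f (update ω b false)| ≤ a) :
    ∫ ω, Real.exp (f ω) ∂bitsMeasure B q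
      ≤ Real.exp (∫ ω, f ω ∂bitsMeasure B q + q * a ^ 2 * #s) := by
  induction s using Finset.induction_on generalizing f with
  | empty =>
    have hconst : f = fun _ => f fun _ => true := funext fun ω => hf (by simp)
    rw [hconst]
    simp
  | insert b s hb ih =>
    let g := coordIntegral (fun _ : B => bernoulliMeasure true false q) b f
    have hgdiff : ∀ b' ∈ s, ∀ ω, |g (update ω b' true) - g (update ω b' false)| ≤ a := by
      intro b' hb' ω
      have hne : b' ≠ b := ne_of_mem_of_not_mem hb' hb
      have htrue := hdiff b' (mem_insert_of_mem hb') (update ω b true)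
      have hfalse := hdiff b' (mem_insert_of_mem hb') (update ω b false)
      simp only [g, coordIntegral_bernoulliMeasure, update_comm hne] at htrue hfalse ⊢
      rw [abs_le] at htrue hfalse ⊢
      constructor <;> nlinarith [q.2.1, q.2.2]
    calc ∫ ω, Real.exp (f ω) ∂bitsMeasure B q
        ≤ ∫ ω, Real.exp (g ω) * Real.exp (q * a ^ 2) ∂bitsMeasure B q := by
          rw [← integral_coordIntegral b]
          refine integral_mono .of_finite .of_finite fun ω => ?_
          exact (coordIntegral_exp_le ha (hdiff b (mem_insert_self b s) ω)).trans_eq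
            (Real.exp_add _ _)
      _ ≤ Real.exp (∫ ω, f ω ∂bitsMeasure B q + q * a ^ 2 * #s) * Real.exp (q * a ^ 2) := by
          rw [integral_mul_const, ← integral_coordIntegral b f]
          gcongr
          exact ih (dependsOn_coordIntegral hf) hgdiff
      _ = _ := by
          rw [← Real.exp_add, card_insert_of_notMem hb]
          push_cast
          ring_nf

lemma bitsMeasure_real_forall_true (s : Finset B) :
    (bitsMeasure B q).real {ω | ∀ b ∈ s, ω b = true} = (q : ℝ) ^ #s := by
  have := measureReal_pi_finset (μ := fun _ : B => bernoulliMeasure true false q) s fun _ => {true}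
  simpa [Set.pi, bernoulliMeasure_real_apply] using this

lemma bitsMeasure_real_forall_false (s : Finset B) :
    (bitsMeasure B q).real {ω | ∀ b ∈ s, ω b = false} = (1 - q : ℝ) ^ #s := by
  have := measureReal_pi_finset (μ := fun _ : B => bernoulliMeasure true false q) s fun _ => {false}
  simpa [Set.pi, bernoulliMeasure_real_apply] using this

lemma integral_exp_card_true_le (s : Finset B) :
    ∫ ω, Real.exp #{b ∈ s | ω b} ∂bitsMeasure B q ≤ Real.exp (2 * q * #s) := by
  let f (b : Bool) : ℝ := if b then Real.exp 1 else 1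
  have hf (b : B) : ∫ ω, f (ω b) ∂bitsMeasure B q ≤ Real.exp (2 * q) := by
    have heval := integral_comp_eval (μ := fun _ : B => bernoulliMeasure true false q) (i := b)
      (f := f) Measurable.of_discrete.aestronglyMeasurable
    have hmean : ∫ k, f k ∂bernoulliMeasure true false q = q * Real.exp 1 + (1 - q) := by
      simp [f, integral_bernoulliMeasure]
    rw [heval, hmean]
    nlinarith [q.2.1, Real.exp_one_lt_three, Real.add_one_le_exp (2 * q : ℝ)]
  calc ∫ ω, Real.exp #{b ∈ s | ω b} ∂bitsMeasure B q
      = ∫ ω, ∏ b ∈ s, f (ω b) ∂bitsMeasure B q := by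
        simp only [f, prod_ite, prod_const, one_pow, mul_one, Real.exp_one_pow]
    _ = ∏ b ∈ s, ∫ ω, f (ω b) ∂bitsMeasure B q :=
        integral_prod_of_dependsOn (s := fun b => {b})
          (fun _ _ _ _ h => disjoint_singleton.2 h) fun b _ x y h => by rw [h b (by simp)]
    _ ≤ ∏ _b ∈ s, Real.exp (2 * q) :=
        prod_le_prod (fun b _ => integral_nonneg fun ω => by positivity) fun b _ => hf b
    _ = _ := by rw [prod_const, ← Real.exp_nat_mul, mul_comm]

lemma card_filter_le_card_add_card_filter_sdiff {B : Type*} (s t : Finset B) (P : B → Prop)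
    [DecidablePred P] : #{b ∈ s | P b} ≤ #t + #{b ∈ s \ t | P b} := by
  have hsub : ({b ∈ s | P b} : Finset B) ⊆ t ∪ {b ∈ s \ t | P b} := fun b hb => by
    by_cases b ∈ t <;> simp_all
  exact (card_le_card hsub).trans (card_union_le _ _)

/-- The factor `exp 2` is the contribution of `b₁` and `b₂` themselves. -/
lemma integral_indicator_mul_exp_card_true_le (s : Finset B) {b₁ b₂ : B} (hb : b₁ ≠ b₂) :
    ∫ ω, (if ω b₁ ∧ ω b₂ then Real.exp #{b ∈ s | ω b} else 0) ∂bitsMeasure B q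
      ≤ q ^ 2 * Real.exp (2 + 2 * q * #s) := by
  let pair : Finset B := {b₁, b₂}
  let f (ω : B → Bool) : ℝ := {ω | ∀ b ∈ pair, ω b}.indicator 1 ω
  let g (ω : B → Bool) : ℝ := Real.exp #{b ∈ s \ pair | ω b}
  have hfg (ω : B → Bool) : (if ω b₁ ∧ ω b₂ then Real.exp #{b ∈ s | ω b} else 0)
      ≤ Real.exp 2 * (f ω * g ω) := by
    by_cases h : ω b₁ ∧ ω b₂
    · have hf : f ω = 1 := Set.indicator_of_mem (by simpa [pair] using h) 1
      rw [if_pos h, hf, one_mul, ← Real.exp_add, Real.exp_le_exp]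
      exact_mod_cast (card_filter_le_card_add_card_filter_sdiff s pair (ω · = true)).trans
        (Nat.add_le_add_right card_le_two _)
    · rw [if_neg h]
      exact mul_nonneg (by positivity)
        (mul_nonneg (Set.indicator_nonneg (by simp) ω) (by positivity))
  have hf : DependsOn f pair := fun x y hxy => by
    have hiff : (∀ b ∈ pair, x b) ↔ ∀ b ∈ pair, y b :=
      forall₂_congr fun b hb => by rw [hxy b hb]
    simp only [f, Set.indicator_apply, Set.mem_ofPred_eq, hiff, Pi.one_apply]
  have hg : DependsOn g (s \ pair : Finset B) := fun x y hxy => by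
    have heq : ({b ∈ s \ pair | x b} : Finset B) = {b ∈ s \ pair | y b} :=
      filter_congr fun b hb => by rw [hxy b hb]
    simp only [g, heq]
  calc _ ≤ ∫ ω, Real.exp 2 * (f ω * g ω) ∂bitsMeasure B q :=
        integral_mono .of_finite .of_finite hfg
    _ = Real.exp 2 * (q ^ 2 * ∫ ω, g ω ∂bitsMeasure B q) := by
        rw [integral_const_mul, integral_mul_of_dependsOn disjoint_sdiff hf hg,
          integral_indicator_one .of_discrete, bitsMeasure_real_forall_true, card_pair hb]
    _ ≤ Real.exp 2 * (q ^ 2 * Real.exp (2 * q * #s)) := by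
        gcongr
        refine (integral_exp_card_true_le _).trans (Real.exp_le_exp.2 ?_)
        have := q.2.1
        gcongr
        exact sdiff_subset
    _ = _ := by rw [Real.exp_add]; ring

end Bits

section Survivors

variable {B U : Type*}

/-- The indices `u ∈ A` all of whose bits `R u` are `false`. -/
noncomputable def survivors (A : Finset U) (R : U → Finset B) (ω : B → Bool) : Finset U :=
  {u ∈ A | ∀ b ∈ R u, ω b = false}

lemma mem_survivors {A : Finset U} {R : U → Finset B} {ω : B → Bool} {u : U} :
    u ∈ survivors A R ω ↔ u ∈ A ∧ ∀ b ∈ R u, ω b = false :=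
  mem_filter

lemma survivors_congr {A : Finset U} {R : U → Finset B} {ω ω' : B → Bool}
    (h : ∀ u ∈ A, ∀ b ∈ R u, ω b = ω' b) : survivors A R ω = survivors A R ω' :=
  filter_congr fun u hu => forall₂_congr fun b hb => by rw [h u hu b hb]

lemma abs_card_survivors_update_sub_le (A : Finset U) (R : U → Finset B) {k : ℕ}
    {b : B} (hk : #{u ∈ A | b ∈ R u} ≤ k) (ω : B → Bool) :
    |(#(survivors A R (update ω b true)) : ℝ) - #(survivors A R (update ω b false))| ≤ k := by
  have hmono : survivors A R (update ω b true) ⊆ survivors A R (update ω b false) := by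
    refine monotone_filter_right A fun u _ hu b' hb' => ?_
    have := hu b' hb'
    rcases eq_or_ne b' b with rfl | hne <;> simp_all
  have hdiff : survivors A R (update ω b false)
      ⊆ survivors A R (update ω b true) ∪ {u ∈ A | b ∈ R u} := by
    intro u hu
    by_cases hb : b ∈ R u
    · exact mem_union_right _ (mem_filter.2 ⟨(mem_survivors.1 hu).1, hb⟩)
    · refine mem_union_left _ (mem_survivors.2 ⟨(mem_survivors.1 hu).1, fun b' hb' => ?_⟩)
      have hne : b' ≠ b := ne_of_mem_of_not_mem hb' hb
      simpa [hne] using (mem_survivors.1 hu).2 b' hb'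
  have hle := card_le_card hmono
  have hge := (card_le_card hdiff).trans ((card_union_le _ _).trans (Nat.add_le_add_left hk _))
  rw [abs_le]
  constructor <;> linarith [(Nat.cast_le (α := ℝ)).2 hle, (Nat.cast_le (α := ℝ)).2 hge,
    Nat.cast_add (R := ℝ) #(survivors A R (update ω b true)) k]

variable [Fintype B] {q : unitInterval}

lemma integral_card_survivors (A : Finset U) (R : U → Finset B) :
    ∫ ω, (#(survivors A R ω) : ℝ) ∂bitsMeasure B q = ∑ u ∈ A, (1 - q : ℝ) ^ #(R u) := by
  have hsum (ω : B → Bool) : (#(survivors A R ω) : ℝ)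
      = ∑ u ∈ A, {ω | ∀ b ∈ R u, ω b = false}.indicator 1 ω := by
    simp only [Set.indicator_apply, Set.mem_ofPred_eq, Pi.one_apply, sum_boole, survivors]
    congr!
  simp only [hsum]
  rw [integral_finsetSum _ fun _ _ => .of_finite]
  refine sum_congr rfl fun u _ => ?_
  rw [integral_indicator_one .of_discrete, bitsMeasure_real_forall_false]

variable {A : Finset U} {R : U → Finset B} {k m : ℕ}

/-- `k` bounds the number of indices that a single bit can influence. -/
lemma mgf_card_survivors_le (hk : ∀ b, #{u ∈ A | b ∈ R u} ≤ k) (hm : ∀ u ∈ A, #(R u) ≤ m) {t : ℝ}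
    (ht : |t| * k ≤ 1) :
    mgf (fun ω => (#(survivors A R ω) : ℝ)) (bitsMeasure B q) t
      ≤ Real.exp (t * ∑ u ∈ A, (1 - q : ℝ) ^ #(R u) + q * (t * k) ^ 2 * (#A * m)) := by
  have hdep : DependsOn (fun ω => t * #(survivors A R ω)) (A.biUnion R : Finset B) :=
    fun x y hxy => congrArg (fun S : Finset U => t * #S) <| survivors_congr fun u hu b hb =>
      hxy b (mem_coe.2 (mem_biUnion.2 ⟨u, hu, hb⟩))
  refine (integral_exp_le_of_bounded_differences ht hdep fun b _ ω => ?_).trans ?_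
  · rw [← mul_sub, abs_mul]
    gcongr
    exact abs_card_survivors_update_sub_le A R (hk b) ω
  · rw [integral_const_mul, integral_card_survivors, Real.exp_le_exp, mul_pow, mul_pow, sq_abs]
    have := q.2.1
    gcongr
    exact_mod_cast card_biUnion_le_card_mul A R m hm

lemma measureReal_le_card_survivors_le (hk : ∀ b, #{u ∈ A | b ∈ R u} ≤ k)
    (hm : ∀ u ∈ A, #(R u) ≤ m) {t x : ℝ} (ht₀ : 0 ≤ t) (ht : t * k ≤ 1) :
    (bitsMeasure B q).real {ω | ∑ u ∈ A, (1 - q : ℝ) ^ #(R u) + x ≤ #(survivors A R ω)}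
      ≤ Real.exp (-(t * x) + q * (t * k) ^ 2 * (#A * m)) := by
  refine (measure_ge_le_exp_mul_mgf _ ht₀ .of_finite).trans ?_
  grw [mgf_card_survivors_le hk hm (by rwa [abs_of_nonneg ht₀]), ← Real.exp_add]
  apply le_of_eq
  ring_nf

lemma measureReal_card_survivors_le_le (hk : ∀ b, #{u ∈ A | b ∈ R u} ≤ k)
    (hm : ∀ u ∈ A, #(R u) ≤ m) {t x : ℝ} (ht₀ : 0 ≤ t) (ht : t * k ≤ 1) :
    (bitsMeasure B q).real {ω | #(survivors A R ω) ≤ ∑ u ∈ A, (1 - q : ℝ) ^ #(R u) - x}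
      ≤ Real.exp (-(t * x) + q * (t * k) ^ 2 * (#A * m)) := by
  refine (measure_le_le_exp_mul_mgf _ (neg_nonpos.2 ht₀) .of_finite).trans ?_
  grw [mgf_card_survivors_le hk hm (by rwa [abs_neg, abs_of_nonneg ht₀]), ← Real.exp_add]
  apply le_of_eq
  ring_nf

end Survivors

lemma induce_iSup {V ι : Type*} (G : ι → SimpleGraph V) (U : Set V) :
    (⨆ i, G i).induce U = ⨆ i, (G i).induce U := by
  ext u v
  simp

/-! ### List colorings from the local lemma -/

lemma uniformOn_real_eq_le {α : Type*} [MeasurableSpace α] [MeasurableSingletonClass α]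
    (s : Finset α) (c : α) : (uniformOn Set.univ : Measure s).real {a | a = c} ≤ (#s : ℝ)⁻¹ := by
  have hone : ({a : s | (a : α) = c} : Set s).encard ≤ 1 :=
    Set.encard_le_one_iff.2 fun a b ha hb => Subtype.ext (ha.trans hb.symm)
  have hcount : (Measure.count {a : s | (a : α) = c}).toReal ≤ 1 := by
    rw [Measure.count_apply .of_discrete]
    refine ENNReal.toReal_le_of_le_ofReal zero_le_one ?_
    rw [ENNReal.ofReal_one]
    exact_mod_cast hone
  rw [Measure.real, uniformOn_univ, ENNReal.toReal_div, ENNReal.toReal_natCast, Fintype.card_coe,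
    inv_eq_one_div]
  gcongr

lemma pi_uniformOn_real_eq_and_eq_le {V α : Type*} [Fintype V] [MeasurableSpace α]
    [MeasurableSingletonClass α] {L : V → Finset α} {ℓ : ℕ} [∀ v, Nonempty (L v)]
    (hL : ∀ v, #(L v) = ℓ) {u v : V} (huv : u ≠ v) (c : α) :
    (Measure.pi fun v => (uniformOn Set.univ : Measure (L v))).real {ω | ω u = c ∧ ω v = c}
      ≤ (ℓ : ℝ)⁻¹ ^ 2 := by
  have (v : V) : IsProbabilityMeasure (uniformOn Set.univ : Measure (L v)) :=
    isProbabilityMeasure_uniformOn Set.finite_univ Set.univ_nonempty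
  calc _ ≤ (Measure.pi fun v => (uniformOn Set.univ : Measure (L v))).real
        ((({u, v} : Finset V) : Set V).pi fun v => {a | a = c}) :=
        measureReal_mono fun ω hω => by simpa [Set.pi] using hω
    _ ≤ (ℓ : ℝ)⁻¹ ^ 2 := by
        rw [measureReal_pi_finset, ← card_pair huv, ← prod_const]
        refine prod_le_prod (fun _ _ => measureReal_nonneg) fun w _ => ?_
        exact hL w ▸ uniformOn_real_eq_le (L w) c

section Graphs

variable {V ι α : Type*} [Fintype V]

/-- The neighbours of `v` whose list contains `c`. -/
noncomputable def colorNbrs (H : SimpleGraph V) (L : V → Finset α) (v : V) (c : α) : Finset V :=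
  {u | H.Adj v u ∧ c ∈ L u}

/-- List colorability of a graph on the whole type `V`. -/
def HasListColoring (H : SimpleGraph V) (L : V → Finset α) : Prop :=
  ∃ φ : H.Coloring α, ∀ v, φ v ∈ L v

variable {H : SimpleGraph V} {L : V → Finset α} {ℓ : ℕ}

lemma mem_colorNbrs {u v : V} {c : α} : u ∈ colorNbrs H L v c ↔ H.Adj v u ∧ c ∈ L u := by
  simp [colorNbrs]

section Sparse

/-- A triple `(u, v, c)` for which the edge `uv` could end up with both ends of color `c`. -/
def IsConflict (H : SimpleGraph V) (L : V → Finset α) (x : V × V × α) : Prop :=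
  H.Adj x.1 x.2.1 ∧ x.2.2 ∈ L x.1 ∧ x.2.2 ∈ L x.2.1

variable {D : ℕ}

lemma card_conflicts_at_le [Fintype α] (hL : ∀ v, #(L v) = ℓ)
    (hD : ∀ v, ∀ c ∈ L v, #(colorNbrs H L v c) ≤ D) (w : V) :
    #{x | IsConflict H L x ∧ w ∈ ({x.1, x.2.1} : Finset V)} ≤ 2 * (ℓ * D) := by
  have hsub : ({x | IsConflict H L x ∧ w ∈ ({x.1, x.2.1} : Finset V)} : Finset (V × V × α))
      ⊆ ((L w).biUnion fun c => (colorNbrs H L w c).image fun u => (w, u, c)) ∪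
        (L w).biUnion fun c => (colorNbrs H L w c).image fun u => (u, w, c) := by
    rintro ⟨u, v, c⟩ hx
    obtain ⟨⟨hadj, hcu, hcv⟩, hw⟩ := (mem_filter.1 hx).2
    simp only [mem_insert, mem_singleton] at hw
    rcases hw with rfl | rfl
    · exact mem_union_left _ (by simp_all [colorNbrs])
    · exact mem_union_right _ (by simp_all [colorNbrs, hadj.symm])
  have hcard (f : V → α → V × V × α) :
      #((L w).biUnion fun c => (colorNbrs H L w c).image fun u => f u c) ≤ ℓ * D := by
    rw [← hL w]
    exact card_biUnion_le_card_mul _ _ _ fun c hc => card_image_le.trans (hD w c hc)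
  rw [two_mul]
  exact (card_le_card hsub).trans ((card_union_le _ _).trans (add_le_add (hcard _) (hcard _)))

/-- The ends of a conflict, and `∅` for the other triples. -/
noncomputable def conflictEnds (H : SimpleGraph V) (L : V → Finset α) (x : V × V × α) : Finset V :=
  if IsConflict H L x then {x.1, x.2.1} else ∅

lemma card_conflictEnds_not_disjoint_le [Fintype α] (hL : ∀ v, #(L v) = ℓ)
    (hD : ∀ v, ∀ c ∈ L v, #(colorNbrs H L v c) ≤ D) (x : V × V × α) :
    #{y | ¬ Disjoint (conflictEnds H L x) (conflictEnds H L y)} ≤ 4 * (ℓ * D) := by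
  have hsub : ({y | ¬ Disjoint (conflictEnds H L x) (conflictEnds H L y)} : Finset (V × V × α))
      ⊆ (conflictEnds H L x).biUnion fun w =>
        {y | IsConflict H L y ∧ w ∈ ({y.1, y.2.1} : Finset V)} := by
    intro y hy
    obtain ⟨w, hwx, hwy⟩ := not_disjoint_iff.1 (mem_filter.1 hy).2
    refine mem_biUnion.2 ⟨w, hwx, mem_filter.2 ⟨mem_univ y, ?_⟩⟩
    rw [conflictEnds] at hwy
    split_ifs at hwy with h
    · exact ⟨h, hwy⟩
    · simp at hwy
  have hcard : #(conflictEnds H L x) ≤ 2 := by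
    rw [conflictEnds]
    split_ifs
    exacts [card_le_two, by simp]
  calc _ ≤ #(conflictEnds H L x) * (2 * (ℓ * D)) :=
        (card_le_card hsub).trans
          (card_biUnion_le_card_mul _ _ _ fun w _ => card_conflicts_at_le hL hD w)
    _ ≤ 2 * (2 * (ℓ * D)) := by gcongr
    _ = _ := by ring

/-- Color every vertex uniformly from its list; the local lemma avoids all conflicts. -/
theorem hasListColoring_of_sparse [Finite α] (hL : ∀ v, #(L v) = ℓ)
    (hD : ∀ v, ∀ c ∈ L v, #(colorNbrs H L v c) ≤ D) (hD₀ : 0 < D) (hDℓ : 16 * D ≤ ℓ) :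
    HasListColoring H L := by
  have := Fintype.ofFinite α
  let _ : MeasurableSpace α := ⊤
  have hℓ : 0 < ℓ := by omega
  have (v : V) : Nonempty (L v) := (card_pos.1 ((hL v).symm ▸ hℓ)).to_subtype
  let μ (v : V) : Measure (L v) := uniformOn Set.univ
  have (v : V) : IsProbabilityMeasure (μ v) :=
    isProbabilityMeasure_uniformOn Set.finite_univ Set.univ_nonempty
  let A (x : V × V × α) : Set (∀ v, L v) :=
    {ω | H.Adj x.1 x.2.1 ∧ ω x.1 = x.2.2 ∧ ω x.2.1 = x.2.2}
  have hA (x : V × V × α) : DependsOn (· ∈ A x) (conflictEnds H L x : Set V) := by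
    intro ω ω' hω
    by_cases hx : IsConflict H L x
    · rw [conflictEnds, if_pos hx] at hω
      simp only [A, Set.mem_ofPred_eq, hω x.1 (by simp), hω x.2.1 (by simp)]
    · have hempty (ω : ∀ v, L v) : ω ∉ A x := fun ⟨hadj, hu, hv⟩ =>
        hx ⟨hadj, hu ▸ (ω x.1).2, hv ▸ (ω x.2.1).2⟩
      simp only [hempty]
  have hp (x : V × V × α) : (Measure.pi μ).real (A x) ≤ (ℓ : ℝ)⁻¹ ^ 2 := by
    by_cases hadj : H.Adj x.1 x.2.1
    · exact (measureReal_mono fun ω hω => hω.2).trans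
        (pi_uniformOn_real_eq_and_eq_le hL hadj.ne x.2.2)
    · have hempty : A x = ∅ := Set.eq_empty_of_forall_notMem fun ω hω => hadj hω.1
      rw [hempty, measureReal_empty]
      positivity
  have hpΔ : 4 * (ℓ : ℝ)⁻¹ ^ 2 * (4 * (ℓ * D) : ℕ) ≤ 1 := by
    have : (16 * D : ℝ) ≤ ℓ := by exact_mod_cast hDℓ
    have : (0 : ℝ) < ℓ := by exact_mod_cast hℓ
    push_cast
    field_simp
    linarith
  obtain ⟨ω, hω⟩ := lovasz_local_lemma_pi hA hp (card_conflictEnds_not_disjoint_le hL hD)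
    (by positivity) hpΔ
  exact ⟨.mk (fun v => ω v) fun {u v} huv heq => hω (u, v, ω u) ⟨huv, rfl, heq.symm⟩,
    fun v => (ω v).2⟩

end Sparse

section NearlyDisjoint

variable [Fintype ι] {G : ι → SimpleGraph V} {N d : ℕ}

/-- Graphs on a common vertex type, any two of which share at most one non-isolated vertex and of
which at most `N` meet at any vertex. -/
structure IsNearlyDisjointFamily (G : ι → SimpleGraph V) (N : ℕ) : Prop where
  subsingleton_inter : Pairwise fun i j => ((G i).support ∩ (G j).support).Subsingleton
  card_support_le (v : V) : #{i | v ∈ (G i).support} ≤ N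

/-- The quantities tracked by the nibble: all lists have size `ℓ`, and all color degrees of the
single graphs `G i` are at most `d`. -/
structure IsColorBounded (G : ι → SimpleGraph V) (L : V → Finset α) (d ℓ : ℕ) : Prop where
  card_list (v : V) : #(L v) = ℓ
  card_colorNbrs_le (i : ι) (v : V) (c : α) : c ∈ L v → #(colorNbrs (G i) L v c) ≤ d

lemma IsColorBounded.card_colorNbrs_iSup_le (hL : IsColorBounded G L d ℓ)
    (hG : IsNearlyDisjointFamily G N) {v : V} {c : α} (hc : c ∈ L v) :
    #(colorNbrs (⨆ i, G i) L v c) ≤ N * d := by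
  have hsub : colorNbrs (⨆ i, G i) L v c
      ⊆ ({i | v ∈ (G i).support} : Finset ι).biUnion fun i => colorNbrs (G i) L v c := by
    intro u hu
    obtain ⟨hadj, hcu⟩ := mem_colorNbrs.1 hu
    obtain ⟨i, hi⟩ := SimpleGraph.iSup_adj.1 hadj
    exact mem_biUnion.2 ⟨i, by simpa using ⟨u, hi⟩, mem_colorNbrs.2 ⟨hi, hcu⟩⟩
  exact (card_le_card hsub).trans
    ((card_biUnion_le_card_mul _ _ _ fun i _ => hL.card_colorNbrs_le i v c hc).trans
      (Nat.mul_le_mul_right d (hG.card_support_le v)))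

end NearlyDisjoint

/-! ### The random bits of a nibble step -/

section NibbleBits

/-- The bit `(u, x, none)` says whether `u` selects the color `x`. The bits `(u, x, some t)` only
serve to give all colors the same probability of surviving at `u`. -/
abbrev NibbleBit (V α : Type*) (n : ℕ) : Type _ :=
  V × α × Option (Fin n)

/-- The bits that must be `false` for the color `x` to survive at `u`. -/
noncomputable def conflictBits (H : SimpleGraph V) (L : V → Finset α) (n : ℕ) (u : V) (x : α) :
    Finset (NibbleBit V α n) :=
  (colorNbrs H L u x).image (fun w => (w, x, none)) ∪
    ({t | t < n - #(colorNbrs H L u x)} : Finset (Fin n)).image fun t => (u, x, some t)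

/-- The bits that are all `false` if `u` selects no color and `c` survives at `u` with respect to
the edges of `H` outside the subgraph `K`. -/
noncomputable def outerBits (K H : SimpleGraph V) (L : V → Finset α) (n : ℕ) (c : α) (u : V) :
    Finset (NibbleBit V α n) :=
  (conflictBits H L n u c \ (colorNbrs K L u c).image fun w => (w, c, none)) ∪
    (L u).image fun x => (u, x, none)

/-- The neighbours of `v` in `K` with `c` in their lists that select the color `x` although `x`
does not survive at them. -/
noncomputable def spoiledNbrs (K H : SimpleGraph V) (L : V → Finset α) (n : ℕ) (v : V) (c x : α)
    (ω : NibbleBit V α n → Bool) : Finset V :=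
  {u ∈ colorNbrs K L v c | x ∈ L u ∧ ω (u, x, none) ∧ ∃ b ∈ conflictBits H L n u x, ω b}

variable {K : SimpleGraph V} {n d : ℕ} {u v w : V} {c x y : α}

lemma select_mem_conflictBits :
    ((w, y, none) : NibbleBit V α n) ∈ conflictBits H L n u x
      ↔ w ∈ colorNbrs H L u x ∧ y = x := by
  simp [conflictBits, eq_comm]

lemma color_of_mem_conflictBits {b : NibbleBit V α n} (hb : b ∈ conflictBits H L n u x) :
    b.2.1 = x := by
  rcases mem_union.1 hb with h | h <;> obtain ⟨_, _, rfl⟩ := mem_image.1 h <;> rfl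

lemma owner_of_mem_conflictBits {b : NibbleBit V α n} (hb : b ∈ conflictBits H L n u x) :
    b.1 ∈ insert u (colorNbrs H L u x) := by
  rcases mem_union.1 hb with h | h <;> obtain ⟨_, hw, rfl⟩ := mem_image.1 h
  exacts [mem_insert_of_mem hw, mem_insert_self u _]

lemma card_conflictBits (hn : #(colorNbrs H L u x) ≤ n) : #(conflictBits H L n u x) = n := by
  have hdisj : Disjoint
      ((colorNbrs H L u x).image fun w => ((w, x, none) : NibbleBit V α n))
      (({t | t < n - #(colorNbrs H L u x)} : Finset (Fin n)).image fun t => (u, x, some t)) := by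
    simp [disjoint_left]
  rw [conflictBits, card_union_of_disjoint hdisj,
    card_image_of_injective _ fun _ _ h => (Prod.ext_iff.1 h).1,
    card_image_of_injective _ fun _ _ h => by simpa using h, Fin.card_filter_val_lt]
  omega

lemma card_mem_conflictBits_le (b : NibbleBit V α n) :
    #{c ∈ L v | b ∈ conflictBits H L n v c} ≤ 1 :=
  card_le_one.2 fun c hc c' hc' => by
    rw [← color_of_mem_conflictBits (mem_filter.1 hc).2,
      color_of_mem_conflictBits (mem_filter.1 hc').2]

lemma le_card_outerBits (hn : #(colorNbrs H L u c) ≤ n) (hd : #(colorNbrs K L u c) ≤ d) :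
    n - d + #(L u) ≤ #(outerBits K H L n c u) := by
  have hdisj : Disjoint
      (conflictBits H L n u c \ (colorNbrs K L u c).image fun w => (w, c, none))
      ((L u).image fun x => ((u, x, none) : NibbleBit V α n)) := by
    refine disjoint_left.2 fun b hb hb' => ?_
    obtain ⟨x, _, rfl⟩ := mem_image.1 hb'
    exact H.irrefl (mem_colorNbrs.1 (select_mem_conflictBits.1 (mem_sdiff.1 hb).1).1).1
  have hsdiff := le_card_sdiff
    ((colorNbrs K L u c).image fun w => ((w, c, none) : NibbleBit V α n)) (conflictBits H L n u c)
  have himage : #((colorNbrs K L u c).image fun w => ((w, c, none) : NibbleBit V α n)) ≤ d :=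
    card_image_le.trans hd
  rw [card_conflictBits hn] at hsdiff
  rw [outerBits, card_union_of_disjoint hdisj,
    card_image_of_injective (L u) fun _ _ h => by simpa using h]
  omega

lemma card_outerBits_le (hn : #(colorNbrs H L u c) ≤ n) :
    #(outerBits K H L n c u) ≤ n + #(L u) :=
  (card_union_le _ _).trans
    (add_le_add ((card_le_card sdiff_subset).trans (card_conflictBits hn).le) card_image_le)

lemma owner_of_mem_outerBits {b : NibbleBit V α n} (hb : b ∈ outerBits K H L n c u) :
    b.1 ∈ insert u (colorNbrs H L u c \ colorNbrs K L u c) := by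
  rcases mem_union.1 hb with h | h
  · obtain ⟨hbH, hbK⟩ := mem_sdiff.1 h
    rcases mem_union.1 hbH with hbH | hbH <;> obtain ⟨w, hw, rfl⟩ := mem_image.1 hbH
    · exact mem_insert_of_mem (mem_sdiff.2 ⟨hw, fun hwK => hbK (mem_image_of_mem _ hwK)⟩)
    · exact mem_insert_self u _
  · obtain ⟨_, _, rfl⟩ := mem_image.1 h
    exact mem_insert_self u _

/-- The edge from `u` to `w` that puts a bit of `w` into `outerBits` comes from a graph other than
`G i`, and by near disjointness this graph determines `u`. -/
lemma IsNearlyDisjointFamily.card_mem_outerBits_le [Fintype ι] {G : ι → SimpleGraph V} {N : ℕ}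
    (hG : IsNearlyDisjointFamily G N) (i : ι) (b : NibbleBit V α n) :
    #{u ∈ colorNbrs (G i) L v c | b ∈ outerBits (G i) (⨆ j, G j) L n c u} ≤ N := by
  have hexists : ∀ u ∈ ({u ∈ colorNbrs (G i) L v c |
      b ∈ outerBits (G i) (⨆ j, G j) L n c u} : Finset V), u ∈ (G i).support ∧
        ∃ j, b.1 ∈ (G j).support ∧ u ∈ (G j).support ∧ (j = i → u = b.1) := by
    intro u hu
    obtain ⟨hu, hb⟩ := mem_filter.1 hu
    have hui : u ∈ (G i).support := ⟨v, (mem_colorNbrs.1 hu).1.symm⟩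
    refine ⟨hui, ?_⟩
    by_cases hub : u = b.1
    · exact ⟨i, hub ▸ hui, hui, fun _ => hub⟩
    obtain ⟨hbH, hbK⟩ := mem_sdiff.1
      ((mem_insert.1 (owner_of_mem_outerBits hb)).resolve_left (Ne.symm hub))
    obtain ⟨hadj, hcb⟩ := mem_colorNbrs.1 hbH
    obtain ⟨j, hj⟩ := SimpleGraph.iSup_adj.1 hadj
    refine ⟨j, ⟨u, hj.symm⟩, ⟨b.1, hj⟩, ?_⟩
    rintro rfl
    exact absurd (mem_colorNbrs.2 ⟨hj, hcb⟩) hbK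
  have : Nonempty ι := ⟨i⟩
  choose! hui f hf using hexists
  refine (card_le_card_of_injOn f (t := {j | b.1 ∈ (G j).support})
    (fun u hu => by simpa using (hf u hu).1) fun u hu u' hu' heq => ?_).trans
      (hG.card_support_le b.1)
  obtain ⟨-, huj, hu_eq⟩ := hf u hu
  obtain ⟨-, huj', hu_eq'⟩ := hf u' hu'
  by_cases hi : f u = i
  · rw [hu_eq hi, hu_eq' (heq ▸ hi)]
  · exact hG.subsingleton_inter hi ⟨huj, hui u hu⟩ ⟨heq ▸ huj', hui u' hu'⟩

lemma mem_spoiledNbrs {ω : NibbleBit V α n → Bool} :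
    u ∈ spoiledNbrs K H L n v c x ω ↔ u ∈ colorNbrs K L v c ∧ x ∈ L u ∧ ω (u, x, none) ∧
      ∃ b ∈ conflictBits H L n u x, ω b :=
  mem_filter

/-- The bits that determine `spoiledNbrs`. -/
noncomputable def spoilingBits (K H : SimpleGraph V) (L : V → Finset α) (n : ℕ) (v : V)
    (c x : α) : Finset (NibbleBit V α n) :=
  {u ∈ colorNbrs K L v c | x ∈ L u}.biUnion fun u =>
    insert (u, x, none) (conflictBits H L n u x)

lemma dependsOn_spoiledNbrs :
    DependsOn (spoiledNbrs K H L n v c x) (spoilingBits K H L n v c x : Set (NibbleBit V α n)) := by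
  intro ω ω' hω
  refine filter_congr fun u hu => and_congr_right fun hx => ?_
  have hbit {b} (hb : b ∈ insert (u, x, none) (conflictBits H L n u x)) : ω b = ω' b :=
    hω b (mem_coe.2 (mem_biUnion.2 ⟨u, mem_filter.2 ⟨hu, hx⟩, hb⟩))
  rw [hbit (mem_insert_self _ _)]
  refine and_congr_right fun _ => exists_congr fun b => and_congr_right fun hb => ?_
  rw [hbit (mem_insert_of_mem hb)]

lemma color_of_mem_spoilingBits {b : NibbleBit V α n} (hb : b ∈ spoilingBits K H L n v c x) :
    b.2.1 = x := by
  obtain ⟨u, -, hb⟩ := mem_biUnion.1 hb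
  rcases mem_insert.1 hb with rfl | hb
  exacts [rfl, color_of_mem_conflictBits hb]

/-- The bits recording which neighbours of `v` in `K` with `c` in their lists select `x`. -/
noncomputable def selectingBits (K : SimpleGraph V) (L : V → Finset α) (n : ℕ) (v : V)
    (c x : α) : Finset (NibbleBit V α n) :=
  {u ∈ colorNbrs K L v c | x ∈ L u}.image fun u => (u, x, none)

lemma exp_card_spoiledNbrs_le (ω : NibbleBit V α n → Bool) :
    Real.exp #(spoiledNbrs K H L n v c x ω)
      ≤ 1 + ∑ u ∈ colorNbrs K L v c with x ∈ L u, ∑ b ∈ conflictBits H L n u x,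
          if ω (u, x, none) ∧ ω b then Real.exp #{b ∈ selectingBits K L n v c x | ω b} else 0 := by
  have hterm (u : V) (b : NibbleBit V α n) : 0 ≤
      if ω (u, x, none) ∧ ω b then Real.exp #{b ∈ selectingBits K L n v c x | ω b} else 0 := by
    split_ifs <;> positivity
  obtain hz | ⟨u, hu⟩ := (spoiledNbrs K H L n v c x ω).eq_empty_or_nonempty
  · rw [hz, card_empty, Nat.cast_zero, Real.exp_zero]
    exact le_add_of_nonneg_right (sum_nonneg fun u _ => sum_nonneg fun b _ => hterm u b)
  have hcard : #(spoiledNbrs K H L n v c x ω) ≤ #{b ∈ selectingBits K L n v c x | ω b} := by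
    refine card_le_card_of_injOn (fun u => (u, x, none)) (fun u hu => ?_) fun u _ u' _ h =>
      (Prod.ext_iff.1 h).1
    obtain ⟨hu, hxu, hsel, -⟩ := mem_spoiledNbrs.1 hu
    exact mem_filter.2 ⟨mem_image_of_mem _ (mem_filter.2 ⟨hu, hxu⟩), hsel⟩
  obtain ⟨hu, hxu, hsel, b, hb, hωb⟩ := mem_spoiledNbrs.1 hu
  calc Real.exp #(spoiledNbrs K H L n v c x ω)
      ≤ Real.exp #{b ∈ selectingBits K L n v c x | ω b} := by gcongr
    _ = if ω (u, x, none) ∧ ω b then Real.exp #{b ∈ selectingBits K L n v c x | ω b} else 0 :=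
        (if_pos ⟨hsel, hωb⟩).symm
    _ ≤ ∑ b ∈ conflictBits H L n u x,
          if ω (u, x, none) ∧ ω b then Real.exp #{b ∈ selectingBits K L n v c x | ω b} else 0 :=
        single_le_sum (fun b _ => hterm u b) hb
    _ ≤ _ := single_le_sum (f := fun u => ∑ b ∈ conflictBits H L n u x, _)
        (fun u _ => sum_nonneg fun b _ => hterm u b) (mem_filter.2 ⟨hu, hxu⟩)
    _ ≤ _ := le_add_of_nonneg_left zero_le_one

section Moments

variable [Fintype α] {q : unitInterval}

lemma integral_exp_card_spoiledNbrs_le (hn : ∀ u, ∀ c ∈ L u, #(colorNbrs H L u c) ≤ n)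
    (hq : (2 * q * #{u ∈ colorNbrs K L v c | x ∈ L u} : ℝ) ≤ 1) :
    ∫ ω, Real.exp #(spoiledNbrs K H L n v c x ω) ∂bitsMeasure (NibbleBit V α n) q
      ≤ Real.exp (21 * q ^ 2 * n * #{u ∈ colorNbrs K L v c | x ∈ L u}) := by
  set A : Finset V := {u ∈ colorNbrs K L v c | x ∈ L u}
  let S := selectingBits K L n v c x
  have hexp : Real.exp (2 + 2 * q * #S) ≤ 21 := by
    have hS : (#S : ℝ) ≤ #A := by exact_mod_cast card_image_le
    calc Real.exp (2 + 2 * q * #S) ≤ Real.exp (3 : ℕ) := by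
          rw [Real.exp_le_exp, Nat.cast_ofNat]
          nlinarith [q.2.1]
      _ = Real.exp 1 ^ 3 := (Real.exp_one_pow 3).symm
      _ ≤ 2.7182818286 ^ 3 := by gcongr; exact Real.exp_one_lt_d9.le
      _ ≤ 21 := by norm_num
  have hpair {u : V} (hu : u ∈ A) : ∑ b ∈ conflictBits H L n u x,
      ∫ ω, (if ω (u, x, none) ∧ ω b then Real.exp #{b ∈ S | ω b} else 0)
        ∂bitsMeasure (NibbleBit V α n) q ≤ n * (q ^ 2 * 21) := by
    refine (sum_le_card_nsmul _ _ (q ^ 2 * 21 : ℝ) fun b hb => ?_).trans_eq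
      (by rw [card_conflictBits (hn u x (mem_filter.1 hu).2), nsmul_eq_mul])
    have hne : (u, x, none) ≠ b := by
      rintro rfl
      exact H.irrefl (mem_colorNbrs.1 (select_mem_conflictBits.1 hb).1).1
    exact (integral_indicator_mul_exp_card_true_le S hne).trans (by gcongr)
  calc _ ≤ ∫ ω, (1 + ∑ u ∈ A, ∑ b ∈ conflictBits H L n u x,
          if ω (u, x, none) ∧ ω b then Real.exp #{b ∈ S | ω b} else 0)
          ∂bitsMeasure (NibbleBit V α n) q :=
        integral_mono .of_finite .of_finite exp_card_spoiledNbrs_le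
    _ = 1 + ∑ u ∈ A, ∑ b ∈ conflictBits H L n u x,
          ∫ ω, (if ω (u, x, none) ∧ ω b then Real.exp #{b ∈ S | ω b} else 0)
            ∂bitsMeasure (NibbleBit V α n) q := by
        rw [integral_add .of_finite .of_finite, integral_finsetSum _ fun _ _ => .of_finite]
        simp only [integral_finsetSum _ fun _ _ => Integrable.of_finite, integral_const,
          probReal_univ, one_smul]
    _ ≤ 1 + ∑ u ∈ A, n * (q ^ 2 * 21 : ℝ) := by gcongr with u hu; exact hpair hu
    _ = 21 * q ^ 2 * n * #A + 1 := by rw [sum_const, nsmul_eq_mul]; ring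
    _ ≤ _ := Real.add_one_le_exp _

/-- For different colors `x` the sets `spoiledNbrs` are determined by disjoint sets of bits. -/
lemma measureReal_le_sum_card_spoiledNbrs_le (hL : ∀ u, #(L u) = ℓ)
    (hn : ∀ u, ∀ c ∈ L u, #(colorNbrs H L u c) ≤ n) (hd : #(colorNbrs K L v c) ≤ d)
    (hq : (2 * q * d : ℝ) ≤ 1) (a : ℝ) :
    (bitsMeasure (NibbleBit V α n) q).real {ω | a ≤ ∑ x, (#(spoiledNbrs K H L n v c x ω) : ℝ)}
      ≤ Real.exp (-a + 21 * q ^ 2 * n * (d * ℓ)) := by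
  have hcard (x : α) : #{u ∈ colorNbrs K L v c | x ∈ L u} ≤ d :=
    (card_le_card (filter_subset _ _)).trans hd
  have hcount : ∑ x : α, #{u ∈ colorNbrs K L v c | x ∈ L u} ≤ d * ℓ := by
    calc ∑ x : α, #{u ∈ colorNbrs K L v c | x ∈ L u}
        = ∑ u ∈ colorNbrs K L v c, #(L u) := by
          simp only [card_filter]
          rw [sum_comm]
          simp
      _ ≤ d * ℓ := by
          simp only [hL, sum_const, smul_eq_mul]
          gcongr
  have hmgf (x : α) : ∫ ω, Real.exp #(spoiledNbrs K H L n v c x ω) ∂bitsMeasure _ q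
      ≤ Real.exp (21 * q ^ 2 * n * #{u ∈ colorNbrs K L v c | x ∈ L u}) := by
    refine integral_exp_card_spoiledNbrs_le hn (le_trans ?_ hq)
    have := q.2.1
    gcongr
    exact hcard x
  have hdisj : ((univ : Finset α) : Set α).PairwiseDisjoint (spoilingBits K H L n v c) :=
    fun x _ y _ hxy => disjoint_left.2 fun b hx hy =>
      hxy ((color_of_mem_spoilingBits hx).symm.trans (color_of_mem_spoilingBits hy))
  refine (measure_ge_le_exp_mul_mgf a zero_le_one .of_finite).trans ?_
  rw [neg_one_mul, Real.exp_add]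
  gcongr
  simp only [mgf, one_mul, Real.exp_sum]
  rw [integral_prod_of_dependsOn hdisj fun x _ ω ω' hω => by rw [dependsOn_spoiledNbrs hω]]
  calc _ ≤ ∏ x, Real.exp (21 * q ^ 2 * n * #{u ∈ colorNbrs K L v c | x ∈ L u}) :=
        prod_le_prod (fun x _ => integral_nonneg fun ω => by positivity) fun x _ => hmgf x
    _ = Real.exp (21 * q ^ 2 * n * (∑ x, #{u ∈ colorNbrs K L v c | x ∈ L u} : ℕ)) := by
        rw [← Real.exp_sum, ← mul_sum, Nat.cast_sum]
    _ ≤ _ := by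
        gcongr
        exact_mod_cast hcount

end Moments

end NibbleBits

/-! ### One nibble step -/

section LocalEvents

/-- The vertex `v` together with its neighbours that share a color with it. -/
noncomputable def colorBall (H : SimpleGraph V) (L : V → Finset α) (v : V) : Finset V :=
  insert v ((L v).biUnion (colorNbrs H L v))

/-- The ball of radius two in the graph of the neighbours that share a color. -/
noncomputable def colorBallTwo (H : SimpleGraph V) (L : V → Finset α) (v : V) : Finset V :=
  (colorBall H L v).biUnion (colorBall H L)

variable {n : ℕ} {u v w : V} {c x : α}

lemma mem_colorBall :
    u ∈ colorBall H L v ↔ u = v ∨ ∃ c ∈ L v, H.Adj v u ∧ c ∈ L u := by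
  simp [colorBall, mem_colorNbrs]

lemma mem_colorBall_symm (h : u ∈ colorBall H L v) : v ∈ colorBall H L u := by
  rw [mem_colorBall] at h ⊢
  rcases h with rfl | ⟨c, hv, hadj, hu⟩
  exacts [.inl rfl, .inr ⟨c, hu, hadj.symm, hv⟩]

lemma mem_colorBallTwo_symm (h : u ∈ colorBallTwo H L v) : v ∈ colorBallTwo H L u := by
  obtain ⟨w, hw, hu⟩ := mem_biUnion.1 h
  exact mem_biUnion.2 ⟨w, mem_colorBall_symm hu, mem_colorBall_symm hw⟩

lemma card_colorBall_le (hL : ∀ v, #(L v) = ℓ) (hn : ∀ v, ∀ c ∈ L v, #(colorNbrs H L v c) ≤ n)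
    (v : V) : #(colorBall H L v) ≤ ℓ * n + 1 := by
  refine (card_insert_le _ _).trans (Nat.add_le_add_right ?_ 1)
  exact (card_biUnion_le_card_mul _ _ _ (hn v)).trans_eq (by rw [hL])

lemma card_colorBallTwo_le (hL : ∀ v, #(L v) = ℓ)
    (hn : ∀ v, ∀ c ∈ L v, #(colorNbrs H L v c) ≤ n) (v : V) :
    #(colorBallTwo H L v) ≤ (ℓ * n + 1) ^ 2 := by
  rw [sq]
  exact (card_biUnion_le_card_mul _ _ _ fun u _ => card_colorBall_le hL hn u).trans
    (Nat.mul_le_mul_right _ (card_colorBall_le hL hn v))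

lemma colorBall_subset_colorBallTwo (hc : c ∈ L v) (hu : u ∈ colorNbrs H L v c) :
    colorBall H L u ⊆ colorBallTwo H L v :=
  subset_biUnion_of_mem _ (mem_insert_of_mem (mem_biUnion.2 ⟨c, hc, hu⟩))

lemma insert_colorNbrs_subset_colorBall (hc : c ∈ L v) :
    insert v (colorNbrs H L v c) ⊆ colorBall H L v :=
  insert_subset_insert _ (subset_biUnion_of_mem _ hc)

variable {K : SimpleGraph V}

lemma colorNbrs_mono (hKH : K ≤ H) : colorNbrs K L v c ⊆ colorNbrs H L v c :=
  monotone_filter_right _ fun _ _ h => ⟨hKH h.1, h.2⟩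

variable [Fintype α]

/-- The bits of the vertices in the ball of radius two around `v`. -/
noncomputable def localBits (H : SimpleGraph V) (L : V → Finset α) (n : ℕ) (v : V) :
    Finset (NibbleBit V α n) :=
  {b | b.1 ∈ colorBallTwo H L v}

lemma card_localBits_not_disjoint_le (hL : ∀ v, #(L v) = ℓ)
    (hn : ∀ v, ∀ c ∈ L v, #(colorNbrs H L v c) ≤ n) (v : V) :
    #{u | ¬ Disjoint (localBits H L n v) (localBits H L n u)} ≤ (ℓ * n + 1) ^ 4 := by
  have hsub : ({u | ¬ Disjoint (localBits H L n v) (localBits H L n u)} : Finset V)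
      ⊆ (colorBallTwo H L v).biUnion (colorBallTwo H L) := by
    intro u hu
    obtain ⟨b, hbv, hbu⟩ := not_disjoint_iff.1 (mem_filter.1 hu).2
    exact mem_biUnion.2
      ⟨b.1, (mem_filter.1 hbv).2, mem_colorBallTwo_symm (mem_filter.1 hbu).2⟩
  calc _ ≤ #(colorBallTwo H L v) * (ℓ * n + 1) ^ 2 :=
        (card_le_card hsub).trans
          (card_biUnion_le_card_mul _ _ _ fun u _ => card_colorBallTwo_le hL hn u)
    _ ≤ (ℓ * n + 1) ^ 2 * (ℓ * n + 1) ^ 2 := by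
        gcongr
        exact card_colorBallTwo_le hL hn v
    _ = _ := by ring

lemma conflictBits_subset_localBits (hc : c ∈ L v) :
    conflictBits H L n v c ⊆ localBits H L n v :=
  fun b hb => mem_filter.2 ⟨mem_univ b, mem_biUnion.2 ⟨v, mem_insert_self v _,
    insert_colorNbrs_subset_colorBall hc (owner_of_mem_conflictBits hb)⟩⟩

lemma outerBits_subset_localBits (hKH : K ≤ H) (hc : c ∈ L v) (hu : u ∈ colorNbrs K L v c) :
    outerBits K H L n c u ⊆ localBits H L n v := by
  intro b hb
  refine mem_filter.2 ⟨mem_univ b, colorBall_subset_colorBallTwo hc (colorNbrs_mono hKH hu) ?_⟩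
  exact insert_colorNbrs_subset_colorBall (mem_colorNbrs.1 hu).2
    (insert_subset_insert u sdiff_subset (owner_of_mem_outerBits hb))

lemma spoilingBits_subset_localBits (hKH : K ≤ H) (hc : c ∈ L v) :
    spoilingBits K H L n v c x ⊆ localBits H L n v := by
  intro b hb
  obtain ⟨u, hu, hb⟩ := mem_biUnion.1 hb
  obtain ⟨hu, hx⟩ := mem_filter.1 hu
  refine mem_filter.2 ⟨mem_univ b, colorBall_subset_colorBallTwo hc (colorNbrs_mono hKH hu) ?_⟩
  rcases mem_insert.1 hb with rfl | hb
  exacts [mem_insert_self u _, insert_colorNbrs_subset_colorBall hx (owner_of_mem_conflictBits hb)]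

end LocalEvents

section NibbleStep

/-- The list sizes guaranteed after a nibble step in which every vertex selects each of its `ℓ`
colors with probability `p / ℓ`. -/
noncomputable def nextList (N d ℓ : ℕ) (p : ℝ) : ℝ :=
  ℓ * (1 - p / ℓ) ^ (N * d) - p ^ 2 * d

/-- The bound for the number of neighbours that select no color and keep a given color as far as
the other graphs are concerned. -/
noncomputable def outerThreshold (N d ℓ : ℕ) (p : ℝ) : ℝ :=
  d * (1 - p / ℓ) ^ (N * d - d + ℓ) + p ^ 2 * d

/-- The color degrees guaranteed after a nibble step: the second summand bounds the number of
neighbours all of whose selected colors are lost. -/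
noncomputable def nextDegree (N d ℓ : ℕ) (p : ℝ) : ℝ :=
  outerThreshold N d ℓ p + 42 * N * p ^ 2 * d

/-- The bound for the probability of each single failure of a nibble step. -/
noncomputable def failureBound (N d : ℕ) (p : ℝ) : ℝ :=
  Real.exp (-(p ^ 3 / (8 * N ^ 3) * d))

/-- The event that at most `a` colors survive at `v`. -/
def fewSurvivors (H : SimpleGraph V) (L : V → Finset α) (n : ℕ) (a : ℝ) (v : V) :
    Set (NibbleBit V α n → Bool) :=
  {ω | #(survivors (L v) (conflictBits H L n v) ω) ≤ a}

/-- The event that at least `a` neighbours of `v` in `K` select no color and keep `c` with respect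
to the edges of `H` outside `K`. -/
def manyOuterSurvivors (K H : SimpleGraph V) (L : V → Finset α) (n : ℕ) (a : ℝ) (v : V) (c : α) :
    Set (NibbleBit V α n → Bool) :=
  {ω | a ≤ #(survivors (colorNbrs K L v c) (outerBits K H L n c) ω)}

/-- The event that the neighbours of `v` in `K` lose at least `a` selected colors. -/
def manySpoiled [Fintype α] (K H : SimpleGraph V) (L : V → Finset α) (n : ℕ) (a : ℝ) (v : V)
    (c : α) : Set (NibbleBit V α n → Bool) :=
  {ω | a ≤ ∑ x, (#(spoiledNbrs K H L n v c x ω) : ℝ)}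

/-- The union of the failures of a nibble step at `v`. -/
def badEvent [Fintype ι] [Fintype α] (G : ι → SimpleGraph V) (L : V → Finset α) (N d ℓ : ℕ)
    (p : ℝ) (v : V) : Set (NibbleBit V α (N * d) → Bool) :=
  fewSurvivors (⨆ i, G i) L (N * d) (nextList N d ℓ p) v ∪
    ⋃ y ∈ ({i | v ∈ (G i).support} : Finset ι) ×ˢ L v,
      manyOuterSurvivors (G y.1) (⨆ i, G i) L (N * d) (outerThreshold N d ℓ p) v y.2 ∪
        manySpoiled (G y.1) (⨆ i, G i) L (N * d) (42 * N * p ^ 2 * d) v y.2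

variable {N d : ℕ} {p : ℝ} {v : V} {c : α}

lemma dependsOn_badEvent [Fintype ι] [Fintype α] {G : ι → SimpleGraph V} :
    DependsOn (· ∈ badEvent G L N d ℓ p v)
      (localBits (⨆ i, G i) L (N * d) v : Set (NibbleBit V α (N * d))) := by
  intro ω ω' hω
  have hG (i : ι) : G i ≤ ⨆ i, G i := le_iSup G i
  have hlist := survivors_congr fun c hc b hb =>
    hω b (conflictBits_subset_localBits (H := ⨆ i, G i) (L := L) (v := v) (n := N * d) hc hb)
  have houter (i : ι) {c : α} (hc : c ∈ L v) := survivors_congr fun u hu b hb =>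
    hω b (outerBits_subset_localBits (n := N * d) (hG i) hc hu hb)
  have hspoiled (i : ι) {c : α} (hc : c ∈ L v) (x : α) :=
    dependsOn_spoiledNbrs (x := x)
      fun b hb => hω b (spoilingBits_subset_localBits (hG i) hc (mem_coe.1 hb))
  simp only [badEvent, Set.mem_union, Set.mem_iUnion, fewSurvivors, manyOuterSurvivors,
    manySpoiled, Set.mem_ofPred_eq, hlist]
  congr! 5 with y hy
  have hc := (mem_product.1 hy).2
  simp only [houter y.1 hc, hspoiled y.1 hc]

variable {q : unitInterval}

lemma measureReal_fewSurvivors_le [Fintype α] (hL : #(L v) = ℓ)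
    (hn : ∀ c ∈ L v, #(colorNbrs H L v c) ≤ N * d) (hN : 1 ≤ N) (hp : 0 < p) (hp₁ : p ≤ 1 / 4)
    (hℓ : 1 ≤ ℓ) (hq : (q : ℝ) = p / ℓ) :
    (bitsMeasure (NibbleBit V α (N * d)) q).real (fewSurvivors H L (N * d) (nextList N d ℓ p) v)
      ≤ failureBound N d p := by
  have : (1 : ℝ) ≤ ℓ := by exact_mod_cast hℓ
  have hN' : (1 : ℝ) ≤ N := by exact_mod_cast hN
  have hmean : ∑ c ∈ L v, (1 - q : ℝ) ^ #(conflictBits H L (N * d) v c)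
      = ℓ * (1 - p / ℓ) ^ (N * d) := by
    rw [sum_congr rfl fun c hc => by rw [card_conflictBits (hn c hc)], sum_const, hL,
      nsmul_eq_mul, hq]
  have htail := measureReal_card_survivors_le_le (q := q) (R := conflictBits H L (N * d) v) (k := 1)
    (fun b => by convert card_mem_conflictBits_le b) (fun c hc => (card_conflictBits (hn c hc)).le)
    (t := p / (2 * N)) (x := p ^ 2 * d) (by positivity)
    (by rw [Nat.cast_one, mul_one, div_le_one (by positivity)]; linarith)
  rw [hmean, hL, hq] at htail
  refine htail.trans (Real.exp_le_exp.2 ?_)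
  push_cast
  calc _ = -(p ^ 3 * d * (1 / (4 * N))) := by field_simp; ring
    _ ≤ -(p ^ 3 * d * (1 / (8 * N ^ 3))) := by
        gcongr
        · norm_num
        · exact le_self_pow₀ hN' (by norm_num)
    _ = _ := by ring

lemma IsColorBounded.measureReal_manyOuterSurvivors_le [Fintype ι] [Fintype α]
    {G : ι → SimpleGraph V} (hL : IsColorBounded G L d ℓ) (hG : IsNearlyDisjointFamily G N)
    (hN : 1 ≤ N) (hp : 0 < p) (hp₁ : p ≤ 1 / 4) (hd : d ≤ ℓ) (hℓ : 1 ≤ ℓ)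
    (hq : (q : ℝ) = p / ℓ) (i : ι) (hc : c ∈ L v) :
    (bitsMeasure (NibbleBit V α (N * d)) q).real
        (manyOuterSurvivors (G i) (⨆ i, G i) L (N * d) (outerThreshold N d ℓ p) v c)
      ≤ failureBound N d p := by
  have : (1 : ℝ) ≤ ℓ := by exact_mod_cast hℓ
  have hN' : (1 : ℝ) ≤ N := by exact_mod_cast hN
  have hd' : (d : ℝ) ≤ ℓ := by exact_mod_cast hd
  have hA : (#(colorNbrs (G i) L v c) : ℝ) ≤ d := by
    exact_mod_cast hL.card_colorNbrs_le i v c hc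
  have hn (u) (hu : u ∈ colorNbrs (G i) L v c) : #(colorNbrs (⨆ i, G i) L u c) ≤ N * d :=
    hL.card_colorNbrs_iSup_le hG (mem_colorNbrs.1 hu).2
  have hmean : ∑ u ∈ colorNbrs (G i) L v c,
      (1 - q : ℝ) ^ #(outerBits (G i) (⨆ i, G i) L (N * d) c u)
        ≤ d * (1 - p / ℓ) ^ (N * d - d + ℓ) := by
    rw [← hq]
    have hq₀ := q.2.1
    have hq₁ := sub_nonneg.2 q.2.2
    refine (sum_le_card_nsmul _ _ ((1 - q : ℝ) ^ (N * d - d + ℓ)) fun u hu => ?_).trans ?_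
    · refine pow_le_pow_of_le_one hq₁ (by linarith) (hL.card_list u ▸ ?_)
      exact le_card_outerBits (hn u hu) (hL.card_colorNbrs_le i u c (mem_colorNbrs.1 hu).2)
    · rw [nsmul_eq_mul]
      gcongr
  have htail := measureReal_le_card_survivors_le (q := q) (m := N * d + ℓ)
    (fun b => by convert hG.card_mem_outerBits_le i b)
    (fun u hu => hL.card_list u ▸ card_outerBits_le (hn u hu))
    (t := p / (4 * N ^ 3)) (x := p ^ 2 * d) (by positivity) (by
      rw [div_mul_eq_mul_div, div_le_one (by positivity)]
      nlinarith [le_self_pow₀ hN' (show 3 ≠ 0 by norm_num)])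
  refine (measureReal_mono fun ω hω => ?_).trans (htail.trans (Real.exp_le_exp.2 ?_))
  · exact (add_le_add_left hmean _).trans hω
  rw [hq]
  push_cast
  have hsize : (N * d + ℓ : ℝ) ≤ 2 * N * ℓ := by nlinarith
  calc _ ≤ -(p / (4 * N ^ 3) * (p ^ 2 * d))
          + p / ℓ * (p / (4 * N ^ 3) * N) ^ 2 * (d * (2 * N * ℓ)) := by gcongr
    _ = _ := by field_simp; ring

lemma IsColorBounded.measureReal_manySpoiled_le [Fintype ι] [Fintype α]
    {G : ι → SimpleGraph V} (hL : IsColorBounded G L d ℓ) (hG : IsNearlyDisjointFamily G N)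
    (hN : 1 ≤ N) (hp : 0 < p) (hp₁ : p ≤ 1 / 4) (hd : d ≤ ℓ) (hℓ : 1 ≤ ℓ)
    (hq : (q : ℝ) = p / ℓ) (i : ι) (hc : c ∈ L v) :
    (bitsMeasure (NibbleBit V α (N * d)) q).real
        (manySpoiled (G i) (⨆ i, G i) L (N * d) (42 * N * p ^ 2 * d) v c)
      ≤ failureBound N d p := by
  have : (1 : ℝ) ≤ ℓ := by exact_mod_cast hℓ
  have hN' : (1 : ℝ) ≤ N := by exact_mod_cast hN
  have hratio : (d : ℝ) / ℓ ≤ 1 := div_le_one_of_le₀ (by exact_mod_cast hd) (by positivity)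
  have hqd : (2 * q * d : ℝ) ≤ 1 := by
    calc (2 * q * d : ℝ) = 2 * p * (d / ℓ) := by rw [hq]; ring
      _ ≤ 2 * p * 1 := by gcongr
      _ ≤ 1 := by linarith
  refine (measureReal_le_sum_card_spoiledNbrs_le hL.card_list
    (fun u c hc => hL.card_colorNbrs_iSup_le hG hc) (hL.card_colorNbrs_le i v c hc) hqd _).trans
      (Real.exp_le_exp.2 ?_)
  have hmean : 21 * (q : ℝ) ^ 2 * (N * d : ℕ) * (d * ℓ) ≤ 21 * N * p ^ 2 * d := by
    calc _ = 21 * N * p ^ 2 * d * (d / ℓ) := by rw [hq]; push_cast; field_simp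
      _ ≤ 21 * N * p ^ 2 * d * 1 := by gcongr
      _ = _ := mul_one _
  have hexp : p ^ 3 / (8 * N ^ 3) * d ≤ 21 * N * p ^ 2 * d := by
    gcongr
    calc p ^ 3 / (8 * N ^ 3) ≤ p ^ 3 :=
          div_le_self (by positivity) (by nlinarith [one_le_pow₀ hN' (n := 3)])
      _ = p * p ^ 2 := by ring
      _ ≤ 21 * N * p ^ 2 := by gcongr; linarith
  linarith

lemma IsColorBounded.measureReal_badEvent_le [Fintype ι] [Fintype α]
    {G : ι → SimpleGraph V} (hL : IsColorBounded G L d ℓ) (hG : IsNearlyDisjointFamily G N)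
    (hN : 1 ≤ N) (hp : 0 < p) (hp₁ : p ≤ 1 / 4) (hd : d ≤ ℓ) (hℓ : 1 ≤ ℓ)
    (hq : (q : ℝ) = p / ℓ) (v : V) :
    (bitsMeasure (NibbleBit V α (N * d)) q).real (badEvent G L N d ℓ p v)
      ≤ 3 * N * ℓ * failureBound N d p := by
  have hNℓ : (1 : ℝ) ≤ N * ℓ := by exact_mod_cast Nat.mul_pos hN hℓ
  have hf : 0 ≤ failureBound N d p := (Real.exp_pos _).le
  have hfew := measureReal_fewSurvivors_le (hL.card_list v)
    (fun c hc => hL.card_colorNbrs_iSup_le hG hc) hN hp hp₁ hℓ hq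
  have hcard : (#(({i | v ∈ (G i).support} : Finset ι) ×ˢ L v) : ℝ) ≤ N * ℓ := by
    rw [card_product, hL.card_list]
    exact_mod_cast Nat.mul_le_mul_right ℓ (hG.card_support_le v)
  have hpairs : (bitsMeasure (NibbleBit V α (N * d)) q).real
      (⋃ y ∈ ({i | v ∈ (G i).support} : Finset ι) ×ˢ L v,
        manyOuterSurvivors (G y.1) (⨆ i, G i) L (N * d) (outerThreshold N d ℓ p) v y.2 ∪
          manySpoiled (G y.1) (⨆ i, G i) L (N * d) (42 * N * p ^ 2 * d) v y.2)
        ≤ N * ℓ * (2 * failureBound N d p) := by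
    refine (measureReal_biUnion_finset_le _ _).trans
      ((sum_le_card_nsmul _ _ (2 * failureBound N d p) fun y hy => ?_).trans ?_)
    · have hc := (mem_product.1 hy).2
      refine (measureReal_union_le _ _).trans ?_
      linarith [hL.measureReal_manyOuterSurvivors_le hG hN hp hp₁ hd hℓ hq y.1 hc,
        hL.measureReal_manySpoiled_le hG hN hp hp₁ hd hℓ hq y.1 hc]
    · rw [nsmul_eq_mul]
      gcongr
  calc _ ≤ failureBound N d p + N * ℓ * (2 * failureBound N d p) :=
        (measureReal_union_le _ _).trans (add_le_add hfew hpairs)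
    _ ≤ N * ℓ * failureBound N d p + N * ℓ * (2 * failureBound N d p) := by
        gcongr
        exact le_mul_of_one_le_left hf hNℓ
    _ = _ := by ring

lemma IsColorBounded.exists_forall_notMem_badEvent [Fintype ι] [Fintype α]
    {G : ι → SimpleGraph V} (hL : IsColorBounded G L d ℓ) (hG : IsNearlyDisjointFamily G N)
    (hN : 1 ≤ N) (hp : 0 < p) (hp₁ : p ≤ 1 / 4) (hd : d ≤ ℓ) (hℓ : 1 ≤ ℓ)
    (hlarge : 12 * N * ℓ * failureBound N d p * (ℓ * (N * d) + 1) ^ 4 ≤ 1) :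
    ∃ ω, ∀ v, ω ∉ badEvent G L N d ℓ p v := by
  have hℓ' : (1 : ℝ) ≤ ℓ := by exact_mod_cast hℓ
  let q : unitInterval := ⟨p / ℓ, by positivity, div_le_one_of_le₀ (by linarith) (by positivity)⟩
  refine lovasz_local_lemma_pi (μ := fun _ => bernoulliMeasure true false q)
    (Δ := (ℓ * (N * d) + 1) ^ 4) (fun v => dependsOn_badEvent)
    (hL.measureReal_badEvent_le hG hN hp hp₁ hd hℓ (q := q) rfl) (fun v => ?_) (by positivity) ?_
  · convert card_localBits_not_disjoint_le hL.card_list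
      (fun u c hc => hL.card_colorNbrs_iSup_le hG hc) v
  · push_cast
    linarith

end NibbleStep

section NibbleOutcome

variable {K : SimpleGraph V} {n : ℕ} {ω : NibbleBit V α n → Bool} {u v : V} {c x : α}

/-- The colors of `v` that are selected by no neighbour and by no additional bit. -/
noncomputable abbrev keptColors (H : SimpleGraph V) (L : V → Finset α) (n : ℕ)
    (ω : NibbleBit V α n → Bool) (v : V) : Finset α :=
  survivors (L v) (conflictBits H L n v) ω

/-- The vertices that select none of their kept colors, and so remain to be colored. -/
def uncolored (H : SimpleGraph V) (L : V → Finset α) (n : ℕ) (ω : NibbleBit V α n → Bool) :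
    Set V :=
  {v | ∀ x ∈ keptColors H L n ω v, ω (v, x, none) = false}

lemma eq_false_of_mem_keptColors (hadj : H.Adj u v) (hxu : x ∈ keptColors H L n ω u)
    (hxv : x ∈ L v) : ω (v, x, none) = false :=
  (mem_survivors.1 hxu).2 _ (select_mem_conflictBits.2 ⟨mem_colorNbrs.2 ⟨hadj, hxv⟩, rfl⟩)

lemma HasListColoring.of_induce_uncolored {L' : uncolored H L n ω → Finset α}
    (hL' : ∀ v, L' v ⊆ keptColors H L n ω v)
    (h : HasListColoring (H.induce (uncolored H L n ω)) L') : HasListColoring H L := by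
  obtain ⟨φ, hφ⟩ := h
  have hkept (v : V) : ∃ x ∈ keptColors H L n ω v,
      (∀ hv : v ∈ uncolored H L n ω, x = φ ⟨v, hv⟩) ∧ (v ∉ uncolored H L n ω → ω (v, x, none)) := by
    by_cases hv : v ∈ uncolored H L n ω
    · exact ⟨φ ⟨v, hv⟩, hL' ⟨v, hv⟩ (hφ ⟨v, hv⟩), fun _ => rfl, fun h => absurd hv h⟩
    · have hselect : ∃ x ∈ keptColors H L n ω v, ω (v, x, none) := by
        by_contra! h
        exact hv fun x hx => by simpa using h x hx
      obtain ⟨x, hx, hωx⟩ := hselect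
      exact ⟨x, hx, fun h => absurd h hv, fun _ => hωx⟩
  choose ψ hψ hψ_eq hψ_select using hkept
  have hψL (v : V) : ψ v ∈ L v := (mem_survivors.1 (hψ v)).1
  have huncolored {u v : V} (hadj : H.Adj u v) (heq : ψ u = ψ v) : v ∈ uncolored H L n ω := by
    by_contra hv
    have hfalse := eq_false_of_mem_keptColors hadj (heq ▸ hψ u) (hψL v)
    simp [hψ_select v hv] at hfalse
  refine ⟨.mk ψ fun {u v} hadj heq => ?_, hψL⟩
  have hu := huncolored hadj.symm heq.symm
  have hv := huncolored hadj heq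
  have hadj' : (H.induce (uncolored H L n ω)).Adj ⟨u, hu⟩ ⟨v, hv⟩ := hadj
  exact φ.valid hadj' (by rw [← hψ_eq u hu, ← hψ_eq v hv, heq])

/-- An uncolored neighbour keeping `c` has selected no color at all, or has lost a selected one. -/
lemma mem_survivors_or_exists_mem_spoiledNbrs (hu : u ∈ uncolored H L n ω)
    (hadj : K.Adj v u) (hc : c ∈ keptColors H L n ω u) :
    u ∈ survivors (colorNbrs K L v c) (outerBits K H L n c) ω ∨
      ∃ x, u ∈ spoiledNbrs K H L n v c x ω := by
  obtain ⟨hcu, hconflict⟩ := mem_survivors.1 hc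
  have huv : u ∈ colorNbrs K L v c := mem_colorNbrs.2 ⟨hadj, hcu⟩
  by_cases hselect : ∃ x ∈ L u, ω (u, x, none)
  · obtain ⟨x, hx, hωx⟩ := hselect
    refine .inr ⟨x, mem_spoiledNbrs.2 ⟨huv, hx, hωx, ?_⟩⟩
    by_contra! hkept
    have := hu x (mem_survivors.2 ⟨hx, fun b hb => by simpa using hkept b hb⟩)
    simp_all
  · push Not at hselect
    refine .inl (mem_survivors.2 ⟨huv, fun b hb => ?_⟩)
    rcases mem_union.1 hb with hb | hb
    · exact hconflict b (mem_sdiff.1 hb).1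
    · obtain ⟨x, hx, rfl⟩ := mem_image.1 hb
      simpa using hselect x hx

lemma card_colorNbrs_induce_uncolored_le [Fintype α] {L' : uncolored H L n ω → Finset α}
    (hL' : ∀ v, L' v ⊆ keptColors H L n ω v) (v : uncolored H L n ω) (c : α) :
    #(colorNbrs (K.induce (uncolored H L n ω)) L' v c)
      ≤ #(survivors (colorNbrs K L v c) (outerBits K H L n c) ω)
        + ∑ x, #(spoiledNbrs K H L n v c x ω) := by
  have hsub : (colorNbrs (K.induce (uncolored H L n ω)) L' v c).image Subtype.val
      ⊆ survivors (colorNbrs K L v c) (outerBits K H L n c) ω ∪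
        univ.biUnion fun x => spoiledNbrs K H L n v c x ω := by
    intro u hu
    obtain ⟨w, hw, rfl⟩ := mem_image.1 hu
    obtain ⟨hadj, hc⟩ := mem_colorNbrs.1 hw
    simpa using mem_survivors_or_exists_mem_spoiledNbrs w.2 hadj (hL' w hc)
  rw [← card_image_of_injective _ Subtype.val_injective]
  exact (card_le_card hsub).trans
    ((card_union_le _ _).trans (Nat.add_le_add_left card_biUnion_le _))

end NibbleOutcome

section NibbleTheorem

lemma IsNearlyDisjointFamily.induce [Fintype ι] {G : ι → SimpleGraph V} {N : ℕ}
    (hG : IsNearlyDisjointFamily G N) (U : Set V) :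
    IsNearlyDisjointFamily (fun i => (G i).induce U) N := by
  have hsupport {i : ι} {v : U} (hv : v ∈ ((G i).induce U).support) :
      (v : V) ∈ (G i).support := by
    obtain ⟨u, hu⟩ := hv
    exact ⟨u, hu⟩
  refine ⟨fun i j hij u hu v hv => ?_, fun v => (card_le_card ?_).trans (hG.card_support_le v)⟩
  · exact Subtype.ext (hG.subsingleton_inter hij ⟨hsupport hu.1, hsupport hu.2⟩
      ⟨hsupport hv.1, hsupport hv.2⟩)
  · exact fun i hi => mem_filter.2 ⟨mem_univ i, hsupport (mem_filter.1 hi).2⟩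

theorem IsColorBounded.exists_nibble [Fintype ι] [Finite α] {G : ι → SimpleGraph V}
    {N d : ℕ} {p : ℝ} (hL : IsColorBounded G L d ℓ) (hG : IsNearlyDisjointFamily G N)
    (hN : 1 ≤ N) (hp : 0 < p) (hp₁ : p ≤ 1 / 4) (hd : d ≤ ℓ) (hℓ : 1 ≤ ℓ)
    (hlarge : 12 * N * ℓ * failureBound N d p * (ℓ * (N * d) + 1) ^ 4 ≤ 1) :
    ∃ (U : Set V) (L' : U → Finset α),
      IsColorBounded (fun i => (G i).induce U) L'
        ⌊nextDegree N d ℓ p⌋₊ ⌈nextList N d ℓ p⌉₊ ∧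
      (HasListColoring (⨆ i, (G i).induce U) L' → HasListColoring (⨆ i, G i) L) := by
  have := Fintype.ofFinite α
  obtain ⟨ω, hω⟩ := hL.exists_forall_notMem_badEvent hG hN hp hp₁ hd hℓ hlarge
  simp only [badEvent, Set.mem_union, Set.mem_iUnion, not_or, not_exists, fewSurvivors,
    manyOuterSurvivors, manySpoiled, Set.mem_ofPred_eq, not_le, mem_product, mem_filter_univ,
    and_imp, Prod.forall] at hω
  have hkept (v : V) : ⌈nextList N d ℓ p⌉₊ ≤ #(keptColors (⨆ i, G i) L (N * d) ω v) :=
    Nat.ceil_le.2 (hω v).1.le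
  choose L' hL' hcard using fun v => exists_subset_card_eq (hkept v)
  refine ⟨uncolored (⨆ i, G i) L (N * d) ω, fun v => L' v, ⟨fun v => hcard v, ?_⟩, fun h => ?_⟩
  · intro i v c hc
    by_cases hv : (v : V) ∈ (G i).support
    · have hcv := (mem_survivors.1 (hL' v hc)).1
      obtain ⟨houter, hspoiled⟩ := (hω v).2 i c hv hcv
      have hcolor := card_colorNbrs_induce_uncolored_le (K := G i) (fun v => hL' v) v c
      refine Nat.le_floor ?_
      rw [nextDegree]
      rify at hcolor
      linarith
    · have hempty : colorNbrs ((G i).induce (uncolored (⨆ i, G i) L (N * d) ω))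
          (fun v => L' v) v c = ∅ :=
        eq_empty_of_forall_notMem fun u hu => hv ⟨u, (mem_colorNbrs.1 hu).1⟩
      simp [hempty]
  · exact .of_induce_uncolored (fun v => hL' v) (by rwa [induce_iSup])

end NibbleTheorem

/-! ### Iterating the nibble -/

section Ratio

variable {N d : ℕ} {p : ℝ}

lemma one_sub_mul_le_one_sub_div_pow {n : ℕ} {a : ℝ} (hp : 0 ≤ p) (hpℓ : p ≤ ℓ) (hℓ : 0 < ℓ)
    (hn : n ≤ a * ℓ) : 1 - a * p ≤ (1 - p / ℓ) ^ n := by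
  have hℓ' : (0 : ℝ) < ℓ := Nat.cast_pos.2 hℓ
  have hpℓ' : p / ℓ ≤ 1 := div_le_one_of_le₀ hpℓ hℓ'.le
  calc 1 - a * p = 1 - a * ℓ * (p / ℓ) := by field_simp
    _ ≤ 1 - n * (p / ℓ) := by gcongr
    _ = 1 + n * (1 - p / ℓ - 1) := by ring
    _ ≤ (1 - p / ℓ) ^ n := one_add_mul_sub_le_pow (by linarith) n

lemma one_sub_div_pow_self_le (hp : 0 ≤ p) (hp₁ : p ≤ 1) (hℓ : 1 ≤ ℓ) :
    (1 - p / ℓ) ^ ℓ ≤ 1 - p + p ^ 2 := by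
  have hpℓ : p ≤ ℓ := hp₁.trans (Nat.one_le_cast.2 hℓ)
  have hexp := (abs_le.1 (Real.abs_exp_sub_one_sub_id_le (x := -p) (by rwa [abs_neg,
    abs_of_nonneg hp]))).2
  linarith [Real.one_sub_div_pow_le_exp_neg hpℓ, neg_sq p]

/-- The drift of the ratio: `y` is the factor common to lists and degrees, coming from the outer
neighbours, `z` is the additional factor of the lists and `u` that of the degrees. -/
lemma one_add_sq_mul_le {n y z u : ℝ} (hn : 1 ≤ n) (hp : 0 ≤ p) (hnp : 200 * n * p ≤ 1)
    (hy : 1 / 2 ≤ y) (hy₁ : y ≤ 1) (hu₀ : 0 ≤ u) (hu : u ≤ 1 - p + p ^ 2)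
    (hz : 1 - (1 - 200 * n * p) * p ≤ z) :
    (1 + p ^ 2) * (y * u + 43 * n * p ^ 2) ≤ y * z - p ^ 2 := by
  have hp₁ : p ≤ 1 / 200 := by nlinarith
  have hpp : p ^ 2 ≤ 1 / 200 := by nlinarith
  have hyu : y * u ≤ 1 := mul_le_one₀ hy₁ hu₀ (by nlinarith)
  have hnpp : p ^ 2 ≤ n * p ^ 2 := le_mul_of_one_le_left (sq_nonneg p) hn
  have hgap : 199 * (n * p ^ 2) ≤ z - u := by linarith
  have hygap : 1 / 2 * (199 * (n * p ^ 2)) ≤ y * (z - u) :=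
    mul_le_mul hy hgap (by positivity) (by linarith)
  have hyu' : p ^ 2 * (y * u) ≤ p ^ 2 * 1 := by gcongr
  have herror : p ^ 2 * (43 * n * p ^ 2) ≤ 1 / 200 * (43 * n * p ^ 2) := by gcongr
  linarith [sq_nonneg p]

lemma nextDegree_nonneg (hpℓ : p ≤ ℓ) : 0 ≤ nextDegree N d ℓ p := by
  have : 0 ≤ 1 - p / ℓ := sub_nonneg.2 (div_le_one_of_le₀ hpℓ (Nat.cast_nonneg ℓ))
  rw [nextDegree, outerThreshold]
  positivity

lemma mul_le_one_of_cast_le (hℓ : 1 ≤ ℓ) (hd : d ≤ (1 - 200 * N * p) * ℓ) :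
    200 * N * p ≤ 1 := by
  have hℓ' : (0 : ℝ) < ℓ := Nat.cast_pos.2 hℓ
  linarith [nonneg_of_mul_nonneg_left ((Nat.cast_nonneg d).trans hd) hℓ']

lemma le_of_cast_le (hp : 0 ≤ p) (hd : d ≤ (1 - 200 * N * p) * ℓ) : d ≤ ℓ := by
  rify
  exact hd.trans (mul_le_of_le_one_left (Nat.cast_nonneg ℓ) (sub_le_self _ (by positivity)))

lemma half_le_one_sub_div_pow (hN : 1 ≤ N) (hp : 0 ≤ p) (hNp : 200 * N * p ≤ 1) (hℓ : 1 ≤ ℓ)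
    (hd : d ≤ ℓ) : 1 / 2 ≤ (1 - p / ℓ) ^ (N * d - d) := by
  have hN' : (1 : ℝ) ≤ N := Nat.one_le_cast.2 hN
  have hℓ' : (1 : ℝ) ≤ ℓ := Nat.one_le_cast.2 hℓ
  have hexponent : N * d - d ≤ N * ℓ := (Nat.sub_le _ _).trans (by gcongr)
  calc (1 : ℝ) / 2 ≤ 1 - N * p := by linarith
    _ ≤ (1 - p / ℓ) ^ (N * d - d) :=
      one_sub_mul_le_one_sub_div_pow hp (by nlinarith) hℓ (mod_cast hexponent)

lemma nextList_eq (hN : 1 ≤ N) :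
    nextList N d ℓ p = ℓ * ((1 - p / ℓ) ^ (N * d - d) * (1 - p / ℓ) ^ d) - p ^ 2 * d := by
  rw [nextList, ← pow_add, Nat.sub_add_cancel (Nat.le_mul_of_pos_left d hN)]

lemma quarter_le_nextList (hN : 1 ≤ N) (hp : 0 ≤ p) (hℓ : 1 ≤ ℓ)
    (hd : d ≤ (1 - 200 * N * p) * ℓ) : (ℓ : ℝ) / 4 ≤ nextList N d ℓ p := by
  have hNp := mul_le_one_of_cast_le hℓ hd
  have hdℓ := le_of_cast_le hp hd
  have hN' : (1 : ℝ) ≤ N := Nat.one_le_cast.2 hN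
  have hℓ' : (1 : ℝ) ≤ ℓ := Nat.one_le_cast.2 hℓ
  have hp₁ : p ≤ 1 / 200 := by nlinarith
  have hy := half_le_one_sub_div_pow hN hp hNp hℓ hdℓ
  have hz : 1 - 1 * p ≤ (1 - p / ℓ) ^ d :=
    one_sub_mul_le_one_sub_div_pow hp (by linarith) hℓ (by simpa using hdℓ)
  calc (ℓ : ℝ) / 4 ≤ ℓ * (1 / 2 * (1 - 1 * p)) - p ^ 2 * ℓ := by nlinarith
    _ ≤ ℓ * ((1 - p / ℓ) ^ (N * d - d) * (1 - p / ℓ) ^ d) - p ^ 2 * d := by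
      gcongr
      linarith
    _ = nextList N d ℓ p := (nextList_eq hN).symm

lemma one_add_sq_mul_nextDegree_le (hN : 1 ≤ N) (hp : 0 ≤ p) (hℓ : 1 ≤ ℓ)
    (hd : d ≤ (1 - 200 * N * p) * ℓ) :
    (1 + p ^ 2) * nextDegree N d ℓ p * ℓ ≤ nextList N d ℓ p * d := by
  have hNp := mul_le_one_of_cast_le hℓ hd
  have hdℓ := le_of_cast_le hp hd
  have hN' : (1 : ℝ) ≤ N := Nat.one_le_cast.2 hN
  have hℓ' : (1 : ℝ) ≤ ℓ := Nat.one_le_cast.2 hℓ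
  have hp₁ : p ≤ 1 := by nlinarith
  have hq : 0 ≤ 1 - p / ℓ := sub_nonneg.2 (div_le_one_of_le₀ (by linarith) (by linarith))
  have hq₁ : 1 - p / ℓ ≤ 1 := sub_le_self _ (by positivity)
  have hz := one_sub_mul_le_one_sub_div_pow hp (by linarith) hℓ hd
  have hdrift := one_add_sq_mul_le hN' hp hNp (half_le_one_sub_div_pow hN hp hNp hℓ hdℓ)
    (pow_le_one₀ hq hq₁) (pow_nonneg hq ℓ) (one_sub_div_pow_self_le hp hp₁ hℓ) hz
  rw [nextList_eq hN, nextDegree, outerThreshold, pow_add]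
  set y := (1 - p / ℓ) ^ (N * d - d)
  set z := (1 - p / ℓ) ^ d
  set u := (1 - p / ℓ) ^ ℓ
  calc (1 + p ^ 2) * (d * (y * u) + p ^ 2 * d + 42 * N * p ^ 2 * d) * ℓ
      ≤ (1 + p ^ 2) * (d * (y * u) + N * p ^ 2 * d + 42 * N * p ^ 2 * d) * ℓ := by
        gcongr
        exact le_mul_of_one_le_left (sq_nonneg p) hN'
    _ = (1 + p ^ 2) * (y * u + 43 * N * p ^ 2) * (d * ℓ) := by ring
    _ ≤ (y * z - p ^ 2) * (d * ℓ) := by gcongr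
    _ = (ℓ * (y * z) - p ^ 2 * ℓ) * d := by ring
    _ ≤ (ℓ * (y * z) - p ^ 2 * d) * d := by gcongr

end Ratio

section Palette

omit [Fintype V] in
lemma HasListColoring.of_subtype {P : Finset α}
    (h : HasListColoring H fun v => (L v).subtype (· ∈ P)) : HasListColoring H L := by
  obtain ⟨φ, hφ⟩ := h
  refine ⟨.mk (fun v => (φ v : α)) fun hadj heq => φ.valid hadj (Subtype.ext heq), fun v => ?_⟩
  exact mem_subtype.1 (hφ v)

lemma IsColorBounded.subtype {G : ι → SimpleGraph V} {d : ℕ} {P : Finset α}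
    (hL : IsColorBounded G L d ℓ) (hP : ∀ v, L v ⊆ P) :
    IsColorBounded G (fun v => (L v).subtype (· ∈ P)) d ℓ where
  card_list v := by rw [card_subtype, filter_true_of_mem fun c hc => hP v hc, hL.card_list]
  card_colorNbrs_le i v c hc := by
    refine (card_le_card fun u hu => ?_).trans (hL.card_colorNbrs_le i v c (mem_subtype.1 hc))
    simpa [mem_colorNbrs] using hu

end Palette

section Iteration

variable {N : ℕ} {p : ℝ}

lemma exists_forall_mul_exp_neg_le_one (hN : 1 ≤ N) {κ : ℝ} (hκ : 0 < κ) :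
    ∃ M : ℕ, ∀ d ℓ : ℕ, M ≤ ℓ → d ≤ ℓ → ℓ ≤ 16 * (N * d) →
      12 * N * ℓ * Real.exp (-(κ * d)) * (ℓ * (N * d) + 1) ^ 4 ≤ 1 := by
  have hN' : (1 : ℝ) ≤ N := Nat.one_le_cast.2 hN
  have hlittle := (isLittleO_pow_exp_pos_mul_atTop 9 (b := κ / (16 * N)) (by positivity)).def
    (c := 1 / (192 * N ^ 5)) (by positivity)
  obtain ⟨x₀, hx₀⟩ := Filter.eventually_atTop.1 hlittle
  refine ⟨max 1 ⌈x₀⌉₊, fun d ℓ hM hd hdℓ => ?_⟩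
  have hℓ' : (1 : ℝ) ≤ ℓ := Nat.one_le_cast.2 (le_of_max_le_left hM)
  have hpow_exp : (ℓ : ℝ) ^ 9 ≤ 1 / (192 * N ^ 5) * Real.exp (κ / (16 * N) * ℓ) := by
    simpa [Real.abs_exp] using hx₀ ℓ (Nat.ceil_le.1 (le_of_max_le_right hM))
  have hexp : κ / (16 * N) * ℓ ≤ κ * d := by
    rify at hdℓ
    calc κ / (16 * N) * ℓ ≤ κ / (16 * N) * (16 * (N * d)) := by gcongr
      _ = κ * d := by field_simp
  have hbase : (ℓ * (N * d) + 1 : ℝ) ≤ 2 * N * ℓ ^ 2 := by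
    calc (ℓ * (N * d) + 1 : ℝ) ≤ ℓ * (N * ℓ) + N * ℓ ^ 2 := by
          gcongr
          exact one_le_mul_of_one_le_of_one_le hN' (one_le_pow₀ hℓ')
      _ = 2 * N * ℓ ^ 2 := by ring
  calc 12 * N * ℓ * Real.exp (-(κ * d)) * (ℓ * (N * d) + 1) ^ 4
      ≤ 12 * N * ℓ * Real.exp (-(κ / (16 * N) * ℓ)) * (2 * N * ℓ ^ 2) ^ 4 := by gcongr
    _ = 192 * N ^ 5 * (ℓ : ℝ) ^ 9 * Real.exp (-(κ / (16 * N) * ℓ)) := by ring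
    _ ≤ 192 * N ^ 5 * (1 / (192 * N ^ 5) * Real.exp (κ / (16 * N) * ℓ))
          * Real.exp (-(κ / (16 * N) * ℓ)) := by gcongr
    _ = 1 := by
      rw [Real.exp_neg]
      field_simp

lemma IsColorBounded.hasListColoring_of_mul_le [Fintype ι] [Finite α] {G : ι → SimpleGraph V}
    {d : ℕ} (hL : IsColorBounded G L d ℓ) (hG : IsNearlyDisjointFamily G N) (hℓ : 16 ≤ ℓ)
    (hd : 16 * (N * d) ≤ ℓ) : HasListColoring (⨆ i, G i) L :=
  hasListColoring_of_sparse (D := max 1 (N * d)) hL.card_list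
    (fun _ _ hc => (hL.card_colorNbrs_iSup_le hG hc).trans (le_max_right _ _)) (by simp) (by omega)

/-- A nibble step multiplies the ratio of list size to color degree by at least `1 + p ^ 2`. -/
lemma one_add_sq_mul_floor_nextDegree_le {d : ℕ} (hN : 1 ≤ N) (hp : 0 ≤ p) (hℓ : 1 ≤ ℓ)
    (hd : d ≤ (1 - 200 * N * p) * ℓ) {a : ℝ} (had : d ≤ a * ℓ) :
    (1 + p ^ 2) * ⌊nextDegree N d ℓ p⌋₊ ≤ a * ⌈nextList N d ℓ p⌉₊ := by
  have hN' : (1 : ℝ) ≤ N := Nat.one_le_cast.2 hN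
  have hℓ' : (1 : ℝ) ≤ ℓ := Nat.one_le_cast.2 hℓ
  have hNp := mul_le_one_of_cast_le hℓ hd
  refine le_of_mul_le_mul_right ?_ (by linarith : (0 : ℝ) < ℓ)
  calc (1 + p ^ 2) * ⌊nextDegree N d ℓ p⌋₊ * ℓ ≤ (1 + p ^ 2) * nextDegree N d ℓ p * ℓ := by
        gcongr
        exact Nat.floor_le (nextDegree_nonneg (by nlinarith))
    _ ≤ nextList N d ℓ p * d := one_add_sq_mul_nextDegree_le hN hp hℓ hd
    _ ≤ ⌈nextList N d ℓ p⌉₊ * (a * ℓ) := by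
        gcongr
        exact Nat.le_ceil _
    _ = a * ⌈nextList N d ℓ p⌉₊ * ℓ := by ring

universe u v w

/-- At most `k` nibble steps reach the sparse case `16 * N * d ≤ ℓ`. -/
lemma exists_forall_hasListColoring_of_le_pow (hN : 1 ≤ N) (hp : 0 < p) (k : ℕ) :
    ∃ M : ℕ, ∀ d ℓ : ℕ, M ≤ ℓ → d ≤ (1 - 200 * N * p) * ℓ →
      d ≤ (1 + p ^ 2) ^ k / (16 * N) * ℓ →
      ∀ (V : Type u) (ι : Type v) (α : Type w) [Fintype V] [Fintype ι] [Finite α]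
        (G : ι → SimpleGraph V) (L : V → Finset α), IsNearlyDisjointFamily G N →
        IsColorBounded G L d ℓ → HasListColoring (⨆ i, G i) L := by
  have hN' : (1 : ℝ) ≤ N := Nat.one_le_cast.2 hN
  induction k with
  | zero =>
    refine ⟨16, fun d ℓ hM _ hsparse V ι α _ _ _ G L hG hL =>
      hL.hasListColoring_of_mul_le hG hM ?_⟩
    rify
    rw [pow_zero, div_mul_eq_mul_div, le_div_iff₀ (by positivity)] at hsparse
    linarith
  | succ k ih =>
    obtain ⟨M₁, hM₁⟩ := ih
    obtain ⟨M₂, hM₂⟩ := exists_forall_mul_exp_neg_le_one hN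
      (κ := p ^ 3 / (8 * N ^ 3)) (by positivity)
    refine ⟨max 16 (max (4 * M₁) M₂), fun d ℓ hM hd hk V ι α _ _ _ G L hG hL => ?_⟩
    obtain ⟨hℓ, hℓ₁, hℓ₂⟩ : 16 ≤ ℓ ∧ 4 * M₁ ≤ ℓ ∧ M₂ ≤ ℓ := by simpa only [max_le_iff] using hM
    by_cases hsparse : 16 * (N * d) ≤ ℓ
    · exact hL.hasListColoring_of_mul_le hG hℓ hsparse
    have hℓ₀ : 1 ≤ ℓ := by omega
    have hdℓ := le_of_cast_le hp.le hd
    have hNp := mul_le_one_of_cast_le hℓ₀ hd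
    obtain ⟨U, L', hL', hcolor⟩ := hL.exists_nibble hG hN hp (by nlinarith) hdℓ hℓ₀
      (hM₂ d ℓ hℓ₂ hdℓ (by omega))
    have hratio {a : ℝ} := one_add_sq_mul_floor_nextDegree_le (a := a) hN hp.le hℓ₀ hd
    refine hcolor (hM₁ _ _ ?_ ?_ ?_ U ι α _ L' (hG.induce U) hL')
    · rify at hℓ₁ ⊢
      linarith [quarter_le_nextList hN hp.le hℓ₀ hd, Nat.le_ceil (nextList N d ℓ p)]
    · refine le_trans ?_ (hratio hd)
      exact le_mul_of_one_le_left (Nat.cast_nonneg _) (by linarith [sq_nonneg p])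
    · refine le_of_mul_le_mul_left ((hratio hk).trans_eq ?_)
        (by positivity : 0 < 1 + p ^ 2)
      ring

theorem exists_forall_hasListColoring (hN : 1 ≤ N) {ε : ℝ} (hε : 0 < ε) :
    ∃ M : ℕ, ∀ d ℓ : ℕ, M ≤ ℓ → (1 + ε) * d ≤ ℓ →
      ∀ (V : Type u) (ι : Type v) (α : Type w) [Fintype V] [Fintype ι]
        (G : ι → SimpleGraph V) (L : V → Finset α), IsNearlyDisjointFamily G N →
        IsColorBounded G L d ℓ → HasListColoring (⨆ i, G i) L := by
  have : (1 : ℝ) ≤ N := Nat.one_le_cast.2 hN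
  obtain ⟨p, hp, hpε⟩ : ∃ p : ℝ, 0 < p ∧ 1 - 200 * N * p = (1 + ε)⁻¹ :=
    ⟨ε / (1 + ε) / (200 * N), by positivity, by field_simp; ring⟩
  obtain ⟨k, hk⟩ := pow_unbounded_of_one_lt (16 * N : ℝ) (lt_add_of_pos_right 1 (pow_pos hp 2))
  obtain ⟨M, hM⟩ := exists_forall_hasListColoring_of_le_pow hN hp k
  refine ⟨M, fun d ℓ hℓ hd V ι α _ _ G L hG hL => ?_⟩
  have hpalette (v : V) : L v ⊆ univ.biUnion L := subset_biUnion_of_mem L (mem_univ v)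
  refine .of_subtype (hM d ℓ hℓ ?_ ?_ V ι _ G _ hG (hL.subtype hpalette))
  · rwa [hpε, le_inv_mul_iff₀ (by positivity)]
  · calc (d : ℝ) ≤ 1 * ℓ := by nlinarith [(Nat.cast_nonneg d : (0 : ℝ) ≤ d)]
      _ ≤ (1 + p ^ 2) ^ k / (16 * N) * ℓ := by
        gcongr
        exact (one_le_div (by positivity)).2 hk.le

end Iteration

end Graphs

section Subgraphs

variable {V ι α : Type*} {G : ι → (⊤ : SimpleGraph V).Subgraph} {L : V → Finset α} {W : Set V}

lemma colorDegree_le_maxColorDegree {H : (⊤ : SimpleGraph V).Subgraph} (hH : H.verts.Finite)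
    {v : V} (hv : v ∈ H.verts) {c : α} (hc : c ∈ L v) :
    colorDegree H L v c ≤ maxColorDegree H L := by
  refine le_csSup ⟨H.verts.ncard, ?_⟩ ⟨v, hv, c, hc, rfl⟩
  rintro _ ⟨v, _, c, _, rfl⟩
  exact Set.ncard_le_ncard (fun u hu => hu.1.snd_mem) hH

lemma iSup_induce_verts_eq_coe :
    ⨆ i, (G i).spanningCoe.induce (⨆ i, G i).verts = (⨆ i, G i).coe := by
  ext u v
  simp

variable [Fintype W]

lemma NearlyDisjoint.isNearlyDisjointFamily [Fintype ι] {N : ℕ} (hG : NearlyDisjoint G)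
    (hN : ∀ v ∈ W, {i | v ∈ (G i).verts}.ncard ≤ N) :
    IsNearlyDisjointFamily (fun i => (G i).spanningCoe.induce W) N := by
  have hverts {i : ι} {v : W} (hv : v ∈ ((G i).spanningCoe.induce W).support) :
      (v : V) ∈ (G i).verts := by
    obtain ⟨u, hu⟩ := hv
    exact SimpleGraph.Subgraph.Adj.fst_mem hu
  refine ⟨fun i j hij u hu v hv => ?_, fun v => le_trans ?_ (hN v v.2)⟩
  · exact Subtype.ext (Set.encard_le_one_iff.1 (hG i j hij) u v ⟨hverts hu.1, hverts hu.2⟩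
      ⟨hverts hv.1, hverts hv.2⟩)
  · rw [← Set.ncard_coe_finset]
    exact Set.ncard_le_ncard fun i hi => hverts (by simpa using hi)

lemma isColorBounded_of_maxColorDegree_le {S : W → Finset α} {d ℓ : ℕ}
    (hfin : ∀ i, (G i).verts.Finite) (hdeg : ∀ i, maxColorDegree (G i) L ≤ d)
    (hSL : ∀ v, S v ⊆ L v) (hS : ∀ v, #(S v) = ℓ) :
    IsColorBounded (fun i => (G i).spanningCoe.induce W) S d ℓ := by
  refine ⟨hS, fun i v c hc => ?_⟩
  by_cases hv : (v : V) ∈ (G i).verts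
  · calc #(colorNbrs ((G i).spanningCoe.induce W) S v c)
        = #((colorNbrs ((G i).spanningCoe.induce W) S v c).image Subtype.val) :=
          (card_image_of_injective _ Subtype.val_injective).symm
      _ ≤ colorDegree (G i) L v c := by
          rw [← Set.ncard_coe_finset]
          refine Set.ncard_le_ncard (fun u hu => ?_)
            ((hfin i).subset fun u hu => hu.1.snd_mem)
          obtain ⟨w, hw, rfl⟩ := mem_image.1 (mem_coe.1 hu)
          obtain ⟨hadj, hcw⟩ := mem_colorNbrs.1 hw
          exact ⟨hadj, hSL w hcw⟩
      _ ≤ d := (colorDegree_le_maxColorDegree (hfin i) hv (hSL v hc)).trans (hdeg i)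
  · have hempty : colorNbrs ((G i).spanningCoe.induce W) S v c = ∅ :=
      eq_empty_of_forall_notMem fun u hu =>
        hv (SimpleGraph.Subgraph.Adj.fst_mem (mem_colorNbrs.1 hu).1)
    simp [hempty]

end Subgraphs

end

theorem theorem1p3 (C ε : ℝ) (hC : 0 < C) (hε : 0 < ε) :
    ∃ D₀ : ℝ, ∀ D : ℝ, D₀ ≤ D →
      ∀ (V : Type*) (α : Type*) (m : ℕ) (G : Fin m → (⊤ : SimpleGraph V).Subgraph)
        (L : V → Finset α),
        (∀ i, (G i).verts.Finite) →
        NearlyDisjoint G →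
        (∀ v ∈ (⨆ i, G i).verts, ({i | v ∈ (G i).verts}.ncard : ℝ) ≤ C) →
        (∀ i, (maxColorDegree (G i) L : ℝ) ≤ D) →
        (∀ v ∈ (⨆ i, G i).verts, (1 + ε) * D ≤ ((L v).card : ℝ)) →
        IsListColorable (⨆ i, G i) L := by
  obtain ⟨M, hM⟩ := exists_forall_hasListColoring (le_max_left 1 ⌊C⌋₊) hε
  refine ⟨M, fun D hD V α m G L hfin hG hmult hdeg hlist => ?_⟩
  have hD₀ : 0 ≤ D := (Nat.cast_nonneg M).trans hD
  have hℓ : (1 + ε) * D ≤ ⌈(1 + ε) * D⌉₊ := Nat.le_ceil _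
  have hMℓ : M ≤ ⌈(1 + ε) * D⌉₊ := by
    rify
    nlinarith
  have hdℓ : (1 + ε) * ⌊D⌋₊ ≤ ⌈(1 + ε) * D⌉₊ := le_trans (by gcongr; exact Nat.floor_le hD₀) hℓ
  have hW : (⨆ i, G i).verts.Finite := by
    rw [SimpleGraph.Subgraph.verts_iSup]
    exact Set.finite_iUnion hfin
  have : Fintype (⨆ i, G i).verts := hW.fintype
  choose S hSL hS using fun v : (⨆ i, G i).verts =>
    Finset.exists_subset_card_eq (Nat.ceil_le.2 (hlist v v.2))
  have hfamily := hG.isNearlyDisjointFamily fun v hv =>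
    (Nat.le_floor (hmult v hv)).trans (le_max_right 1 _)
  have hbounded := isColorBounded_of_maxColorDegree_le hfin (fun i => Nat.le_floor (hdeg i)) hSL hS
  have hcolor := hM _ _ hMℓ hdℓ _ _ _ _ S hfamily hbounded
  rw [iSup_induce_verts_eq_coe] at hcolor
  exact hcolor.imp fun φ hφ v => hSL v (hφ v)
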